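/- Let $P$ be the regular dodecahedron, with the combinatorial (edge-path) distance on its set of $20$ vertices, and for $r\in\{2,3\}$ let $\operatorname{VR}_{\le r}$ be the Vietoris--Rips complex whose simplices are the nonempty sets of vertices of $P$ of diameter at most $r$. There are exactly ten sets $\tau_1,\dots,\tau_{10}$ of four vertices of $P$ any two of which have distance $3$. These are maximal simplices of $\operatorname{VR}_{\le 3}$, so $Y=\operatorname{VR}_{\le 3}\setminus\{\tau_1,\dots,\tau_{10}\}$ is a simplicial complex; it contains $\operatorname{VR}_{\le 2}$, and each boundary $\partial\tau_i$ is a simplicial $2$-cycle of $Y$. Then, for simplicial homology with integer coefficients: (1) for each $i$ the class $[\partial\tau_i]$ generates $H_2(Y)$; (2) the inclusion $\operatorname{VR}_{\le 2}\subseteq Y$ induces an isomorphism $H_2(\operatorname{VR}_{\le 2})\cong H_2(Y)$; (3) for every triangulation $T$, without additional vertices, of the boundary $2$-sphere of $P$, one has $H_2(T)\cong\mathbb{Z}$, and the inclusion $T\subseteq\operatorname{VR}_{\le 2}$ induces an isomorphism $H_2(T)\cong H_2(\operatorname{VR}_{\le 2})$. In particular \[ H_2(Y)\cong H_2(\operatorname{VR}_{\le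 2})\cong H_2(T)\cong\mathbb{Z}, \] where $H_2(T)=H_2(S^2)$ is the second homology of the $2$-sphere triangulated by $T$. -/

import Mathlib

/-! ### Simplicial homology with integer coefficients -/

namespace SimplicialHomology

variable {V : Type*} [LinearOrder V]

/-- The boundary of the simplex `s`, oriented by the increasing order of its vertices: the
alternating sum of the facets `s \ {v}`, with sign `(-1) ^ i` when `v` is the vertex number `i`
(counted from `0`). The boundary of a `0`-simplex is `0`. -/
noncomputable def simplexBoundary (s : Finset V) : Finset V →₀ ℤ :=
  if s.card ≤ 1 then 0
  else ∑ v ∈ s, Finsupp.single (s.erase v) ((-1) ^ (s.filter (· < v)).card)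

/-- The simplicial boundary operator, on integral combinations of finite vertex sets. The basis
element of `s` stands for the simplex `s` oriented by the increasing order of its vertices. -/
noncomputable def boundary : (Finset V →₀ ℤ) →ₗ[ℤ] (Finset V →₀ ℤ) :=
  Finsupp.linearCombination ℤ simplexBoundary

/-- The group `C_n(K)` of simplicial `n`-chains. -/
def chains (K : PreAbstractSimplicialComplex V) (n : ℕ) : Submodule ℤ (Finset V →₀ ℤ) :=
  Finsupp.supported ℤ ℤ {s | s ∈ K.faces ∧ s.card = n + 1}

/-- The group `Z_n(K)` of simplicial `n`-cycles. -/
noncomputable def cycles (K : PreAbstractSimplicialComplex V) (n : ℕ) :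
    Submodule ℤ (Finset V →₀ ℤ) :=
  chains K n ⊓ LinearMap.ker boundary

/-- The group `B_n(K)` of simplicial `n`-boundaries. -/
noncomputable def boundaries (K : PreAbstractSimplicialComplex V) (n : ℕ) :
    Submodule ℤ (Finset V →₀ ℤ) :=
  (chains K (n + 1)).map boundary

theorem boundary_single (s : Finset V) (c : ℤ) :
    boundary (Finsupp.single s c) = c • simplexBoundary s := by
  simp [boundary]

theorem boundary_simplexBoundary (s : Finset V) : boundary (simplexBoundary s) = 0 := by
  by_cases h1 : s.card ≤ 1
  · simp [simplexBoundary, h1]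
  by_cases h2 : s.card ≤ 2
  · rw [simplexBoundary, if_neg h1, map_sum]
    refine Finset.sum_eq_zero fun v hv => ?_
    rw [boundary_single, simplexBoundary, if_pos (by rw [Finset.card_erase_of_mem hv]; omega),
      smul_zero]
  rw [simplexBoundary, if_neg h1, map_sum]
  have key : ∀ v ∈ s, boundary (Finsupp.single (s.erase v)
      ((-1 : ℤ) ^ (s.filter (· < v)).card)) =
      ∑ w ∈ s.erase v, Finsupp.single ((s.erase v).erase w)
        ((-1 : ℤ) ^ (s.filter (· < v)).card * (-1) ^ ((s.erase v).filter (· < w)).card) := by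
    intro v hv
    rw [boundary_single, simplexBoundary,
      if_neg (by rw [Finset.card_erase_of_mem hv]; omega), Finset.smul_sum]
    simp
  rw [Finset.sum_congr rfl key, Finset.sum_sigma']
  have aux : ∀ v ∈ s, ∀ w ∈ s, v < w →
      ((-1 : ℤ) ^ (s.filter (· < v)).card * (-1) ^ ((s.erase v).filter (· < w)).card) +
      ((-1 : ℤ) ^ (s.filter (· < w)).card * (-1) ^ ((s.erase w).filter (· < v)).card) = 0 := by
    intro v hv w hw hvw
    have e1 : (s.erase v).filter (· < w) = (s.filter (· < w)).erase v := by
      ext x; simp only [Finset.mem_filter, Finset.mem_erase]; tauto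
    have e2 : (s.erase w).filter (· < v) = s.filter (· < v) := by
      ext x
      simp only [Finset.mem_filter, Finset.mem_erase]
      constructor
      · tauto
      · rintro ⟨hx, hxv⟩
        exact ⟨⟨(hxv.trans hvw).ne, hx⟩, hxv⟩
    have hm : v ∈ s.filter (· < w) := by simp [hv, hvw]
    have e3 : (s.filter (· < w)).card = ((s.filter (· < w)).erase v).card + 1 :=
      (Finset.card_erase_add_one hm).symm
    rw [e1, e2, e3, pow_succ]
    ring
  refine Finset.sum_involution (fun p _ => ⟨p.2, p.1⟩) ?_ ?_ ?_ ?_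
  · rintro ⟨v, w⟩ hp
    simp only [Finset.mem_sigma, Finset.mem_erase] at hp
    obtain ⟨hv, hwv, hw⟩ := hp
    simp only
    rw [Finset.erase_right_comm (a := w) (b := v), ← Finsupp.single_add]
    rcases lt_or_gt_of_ne hwv with h | h
    · rw [add_comm, aux w hw v hv h, Finsupp.single_zero]
    · rw [aux v hv w hw h, Finsupp.single_zero]
  · rintro ⟨v, w⟩ hp _ h
    simp only [Finset.mem_sigma, Finset.mem_erase] at hp
    simp only [Sigma.mk.injEq] at h
    exact hp.2.1 h.1
  · rintro ⟨v, w⟩ hp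
    simp only [Finset.mem_sigma, Finset.mem_erase] at hp ⊢
    exact ⟨hp.2.2, fun h => hp.2.1 h.symm, hp.1⟩
  · rintro ⟨v, w⟩ _
    rfl

/-- `∂ ∘ ∂ = 0`. -/
theorem boundary_boundary (c : Finset V →₀ ℤ) : boundary (boundary c) = 0 := by
  induction c using Finsupp.induction_linear with
  | zero => simp
  | add f g hf hg => simp [hf, hg]
  | single s a => rw [boundary_single, map_smul, boundary_simplexBoundary, smul_zero]

theorem boundary_mem_chains (K : PreAbstractSimplicialComplex V) (n : ℕ) {c : Finset V →₀ ℤ}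
    (hc : c ∈ chains K (n + 1)) : boundary c ∈ chains K n := by
  rw [boundary, Finsupp.linearCombination_apply]
  refine Submodule.sum_mem _ fun s hs => Submodule.smul_mem _ _ ?_
  obtain ⟨hsK, hcard⟩ := (Finsupp.mem_supported ℤ c).1 hc hs
  rw [simplexBoundary]
  split_ifs
  · exact Submodule.zero_mem _
  · refine Submodule.sum_mem _ fun v hv => Finsupp.single_mem_supported ℤ _ ?_
    have h2 : (s.erase v).card = n + 1 := by rw [Finset.card_erase_of_mem hv]; omega
    exact ⟨(K.isRelLowerSet_faces hsK).2 (Finset.erase_subset _ _)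
      (Finset.card_pos.1 (by omega)), h2⟩

theorem boundaries_le_cycles (K : PreAbstractSimplicialComplex V) (n : ℕ) :
    boundaries K n ≤ cycles K n := by
  rintro _ ⟨c, hc, rfl⟩
  exact ⟨boundary_mem_chains K n hc, boundary_boundary c⟩

theorem chains_mono {W : Type*} {K L : PreAbstractSimplicialComplex W} (h : K ≤ L) (n : ℕ) :
    chains K n ≤ chains L n :=
  Finsupp.supported_mono fun _ hs => ⟨h hs.1, hs.2⟩

theorem cycles_mono {K L : PreAbstractSimplicialComplex V} (h : K ≤ L) (n : ℕ) :
    cycles K n ≤ cycles L n :=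
  inf_le_inf_right _ (chains_mono h n)

/-- The simplicial homology group `H_n(K) = Z_n(K) / B_n(K)` with integer coefficients. -/
abbrev Homology (K : PreAbstractSimplicialComplex V) (n : ℕ) : Type _ :=
  cycles K n ⧸ (boundaries K n).submoduleOf (cycles K n)

/-- The homology class `[z]` of an `n`-cycle `z` of `K`. -/
noncomputable def homologyClass (K : PreAbstractSimplicialComplex V) (n : ℕ) (z : Finset V →₀ ℤ)
    (hz : z ∈ cycles K n) : Homology K n :=
  Submodule.Quotient.mk ⟨z, hz⟩

/-- The map `H_n(K) → H_n(L)` induced by the inclusion of a subcomplex `K` of `L`. -/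
noncomputable def homologyMap {K L : PreAbstractSimplicialComplex V} (h : K ≤ L) (n : ℕ) :
    Homology K n →ₗ[ℤ] Homology L n :=
  Submodule.mapQ _ _ (Submodule.inclusion (cycles_mono h n)) fun _ hz =>
    Submodule.map_mono (chains_mono h (n + 1)) hz

end SimplicialHomology

/-! ### Vietoris-Rips complexes of graphs -/

/-- The Vietoris-Rips complex `VR_{≤ r}` of the vertex set of a graph with the combinatorial
distance: its simplices are the nonempty finite vertex sets of diameter at most `r`. -/
def vietorisRips {V : Type*} (G : SimpleGraph V) (r : ℕ) : PreAbstractSimplicialComplex V where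
  faces := {s | s.Nonempty ∧ ∀ x ∈ s, ∀ y ∈ s, G.edist x y ≤ r}
  isRelLowerSet_faces _ hs :=
    ⟨hs.1, fun _ hts ht => ⟨ht, fun x hx y hy => hs.2 x (hts hx) y (hts hy)⟩⟩

/-- Removing from `K` the simplices in `S`, together with all simplices of `K` of which they are
faces. For a set `S` of maximal simplices of `K` these are just the simplices in `S`. -/
def removeSimplices {V : Type*} (K : PreAbstractSimplicialComplex V) (S : Set (Finset V)) :
    PreAbstractSimplicialComplex V where
  faces := {s | s ∈ K.faces ∧ ∀ t ∈ S, ¬ t ⊆ s}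
  isRelLowerSet_faces _ hs :=
    ⟨(K.isRelLowerSet_faces hs.1).1, fun _ hts ht =>
      ⟨(K.isRelLowerSet_faces hs.1).2 hts ht, fun u hu hut => hs.2 u hu (hut.trans hts)⟩⟩

/-- The tetrahedra (sets of four vertices) any two of whose vertices have distance `3`. -/
def distanceThreeTetrahedra {V : Type*} (G : SimpleGraph V) : Set (Finset V) :=
  {s | s.card = 4 ∧ ∀ x ∈ s, ∀ y ∈ s, x ≠ y → G.edist x y = 3}

/-! ### The dodecahedron -/

namespace Dodecahedron

/-- The vertices of a regular dodecahedron, with exact coordinates in `ℤ[√5]`: for the golden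
ratio `φ = (1 + √5) / 2` these are twice the points `(±1, ±1, ±1)`, `(0, ±φ⁻¹, ±φ)`,
`(±φ⁻¹, ±φ, 0)` and `(±φ, 0, ±φ⁻¹)`, where `2 φ = 1 + √5` and `2 φ⁻¹ = -1 + √5`. -/
def coord : Fin 20 → Fin 3 → ℤ√5 :=
  ![![2, 2, 2], ![2, 2, -2], ![2, -2, 2], ![2, -2, -2],
    ![-2, 2, 2], ![-2, 2, -2], ![-2, -2, 2], ![-2, -2, -2],
    ![0, ⟨-1, 1⟩, ⟨1, 1⟩], ![0, ⟨-1, 1⟩, ⟨-1, -1⟩],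
    ![0, ⟨1, -1⟩, ⟨1, 1⟩], ![0, ⟨1, -1⟩, ⟨-1, -1⟩],
    ![⟨-1, 1⟩, ⟨1, 1⟩, 0], ![⟨-1, 1⟩, ⟨-1, -1⟩, 0],
    ![⟨1, -1⟩, ⟨1, 1⟩, 0], ![⟨1, -1⟩, ⟨-1, -1⟩, 0],
    ![⟨1, 1⟩, 0, ⟨-1, 1⟩], ![⟨-1, -1⟩, 0, ⟨-1, 1⟩],
    ![⟨1, 1⟩, 0, ⟨1, -1⟩], ![⟨-1, -1⟩, 0, ⟨1, -1⟩]]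

/-- The squared Euclidean distance of two vertices. -/
def sqDist (i j : Fin 20) : ℤ√5 := ∑ k, (coord i k - coord j k) ^ 2

/-- The edge graph of the dodecahedron. Its edges join the vertices at the smallest distance
`2 (√5 - 1)`, whose square is `24 - 8 √5`; see `adj_iff_dist_minimal`. -/
def graph : SimpleGraph (Fin 20) where
  Adj i j := sqDist i j = ⟨24, -8⟩
  symm := ⟨fun i j h => by
    rw [← h]; exact Finset.sum_congr rfl fun k _ => by ring⟩
  loopless := ⟨fun i h => by
    have h0 : sqDist i i = 0 := by simp [sqDist]
    rw [h0] at h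
    exact absurd h (by decide)⟩

instance : DecidableRel graph.Adj := fun i j => decEq (sqDist i j) ⟨24, -8⟩

/-- The vertices as points of the unit sphere. -/
noncomputable def point (i : Fin 20) : EuclideanSpace ℝ (Fin 3) :=
  (1 / (2 * √3) : ℝ) • WithLp.toLp 2 fun k =>
    Zsqrtd.toReal (d := 5) (by norm_num) (coord i k)

theorem dist_point_sq (i j : Fin 20) : dist (point i) (point j) ^ 2 =
    Zsqrtd.toReal (d := 5) (by norm_num) (sqDist i j) / 12 := by
  have h3 : (√3 : ℝ) ^ 2 = 3 := Real.sq_sqrt (by norm_num)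
  rw [EuclideanSpace.dist_eq, Real.sq_sqrt (Finset.sum_nonneg fun _ _ => sq_nonneg _), sqDist,
    map_sum, Finset.sum_div]
  refine Finset.sum_congr rfl fun k _ => ?_
  rw [Real.dist_eq, sq_abs, map_pow, map_sub]
  simp only [point, PiLp.smul_apply, smul_eq_mul]
  rw [← mul_sub, mul_pow, div_pow, mul_pow, h3]
  ring

theorem sqDist_values (i j : Fin 20) (h : i ≠ j) :
    sqDist i j = ⟨24, -8⟩ ∨ sqDist i j = ⟨16, 0⟩ ∨ sqDist i j = ⟨32, 0⟩ ∨
      sqDist i j = ⟨24, 8⟩ ∨ sqDist i j = ⟨48, 0⟩ := by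
  revert i j
  decide +kernel

theorem norm_point (i : Fin 20) : ‖point i‖ = 1 := by
  have h : ∀ i, ∑ k, coord i k ^ 2 = 12 := by decide +kernel
  have h3 : (√3 : ℝ) ^ 2 = 3 := Real.sq_sqrt (by norm_num)
  have h' := congrArg (Zsqrtd.toReal (d := 5) (by norm_num)) (h i)
  rw [map_sum] at h'
  simp only [map_pow, map_ofNat] at h'
  rw [← sq_eq_sq₀ (norm_nonneg _) zero_le_one, EuclideanSpace.norm_sq_eq]
  simp only [point, PiLp.smul_apply, smul_eq_mul, Real.norm_eq_abs, sq_abs, mul_pow]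
  rw [← Finset.mul_sum, h', div_pow, mul_pow, h3]
  norm_num

/-- Two vertices are adjacent if and only if they are distinct vertices at the smallest Euclidean
distance: the edges of the graph are the edges of the dodecahedron. -/
theorem adj_iff_dist_minimal (i j : Fin 20) : graph.Adj i j ↔
    i ≠ j ∧ ∀ k l, k ≠ l → dist (point i) (point j) ≤ dist (point k) (point l) := by
  have h5 : (√5 : ℝ) ^ 2 = 5 := Real.sq_sqrt (by norm_num)
  have h5' : (2 : ℝ) < √5 := Real.lt_sqrt_of_sq_lt (by norm_num)
  have hr : ∀ a b : ℤ, Zsqrtd.toReal (d := 5) (by norm_num) ⟨a, b⟩ = a + b * √5 := by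
    intro a b; simp [Zsqrtd.toReal]
  constructor
  · intro h
    refine ⟨h.ne, fun k l hkl => ?_⟩
    rw [← sq_le_sq₀ dist_nonneg dist_nonneg, dist_point_sq, dist_point_sq,
      show sqDist i j = ⟨24, -8⟩ from h]
    rcases sqDist_values k l hkl with e | e | e | e | e <;> simp only [e, hr] <;> push_cast <;>
      linarith
  · rintro ⟨hij, hmin⟩
    have h := hmin 0 8 (by decide)
    rw [← sq_le_sq₀ dist_nonneg dist_nonneg, dist_point_sq, dist_point_sq,
      show sqDist 0 8 = ⟨24, -8⟩ by decide +kernel] at h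
    rcases sqDist_values i j hij with e | e | e | e | e
    · exact e
    all_goals
      exfalso
      rw [e, hr, hr] at h
      push_cast at h
      linarith

/-- The vertex sets of the pentagonal facets of the dodecahedron: the sets of five vertices that
span a `2`-regular subgraph, that is, a `5`-cycle. -/
def IsFacet (F : Finset (Fin 20)) : Prop :=
  F.card = 5 ∧ ∀ x ∈ F, (F.filter (graph.Adj x)).card = 2

instance : DecidablePred IsFacet := fun F =>
  inferInstanceAs (Decidable (F.card = 5 ∧ ∀ x ∈ F, (F.filter (graph.Adj x)).card = 2))

/-- The triangulation, without additional vertices, of the boundary sphere of the dodecahedron in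
which each facet `F` is cut by the two diagonals through its vertex `apex F`: the maximal simplices
are the triangles consisting of `apex F` and the ends of an edge of `F` not containing it. As every
triangulation of a pentagon without additional vertices is cut out by two diagonals with a common
vertex, all triangulations of the boundary without additional vertices are of this form. -/
def boundarySphere (apex : Finset (Fin 20) → Fin 20) :
    PreAbstractSimplicialComplex (Fin 20) where
  faces := {s | s.Nonempty ∧ ∃ F, IsFacet F ∧ ∃ x ∈ F, ∃ y ∈ F, graph.Adj x y ∧
    s ⊆ {apex F, x, y}}
  isRelLowerSet_faces _ hs :=
    ⟨hs.1, fun _ hts ht => ⟨ht, hs.2.imp fun _ hF => ⟨hF.1, hF.2.imp fun _ hx =>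
      ⟨hx.1, hx.2.imp fun _ hy => ⟨hy.1, hy.2.1, hts.trans hy.2.2⟩⟩⟩⟩⟩

theorem edist_le_two_of_isFacet {F : Finset (Fin 20)} (hF : IsFacet F) {x y : Fin 20}
    (hx : x ∈ F) (hy : y ∈ F) : graph.edist x y ≤ 2 := by
  by_cases hxy : x = y
  · subst hxy; simp
  by_cases ha : graph.Adj x y
  · exact (SimpleGraph.edist_le ha.toWalk).trans (by simp)
  have hsub : F.filter (graph.Adj x) ∪ F.filter (graph.Adj y) ⊆ (F.erase x).erase y := by
    intro z hz
    simp only [Finset.mem_union, Finset.mem_filter, Finset.mem_erase] at hz ⊢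
    rcases hz with ⟨hzF, hz⟩ | ⟨hzF, hz⟩
    · exact ⟨fun h => ha (h ▸ hz), hz.ne', hzF⟩
    · exact ⟨hz.ne', fun h => ha (h ▸ hz).symm, hzF⟩
  have hc := Finset.card_le_card hsub
  rw [Finset.card_erase_of_mem (Finset.mem_erase.2 ⟨Ne.symm hxy, hy⟩),
    Finset.card_erase_of_mem hx, hF.1] at hc
  have hu := Finset.card_union_add_card_inter (F.filter (graph.Adj x)) (F.filter (graph.Adj y))
  rw [hF.2 x hx, hF.2 y hy] at hu
  obtain ⟨z, hz⟩ := Finset.card_pos.1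
    (show 0 < (F.filter (graph.Adj x) ∩ F.filter (graph.Adj y)).card by omega)
  simp only [Finset.mem_inter, Finset.mem_filter] at hz
  exact (SimpleGraph.edist_le (.cons hz.1.2 (.cons hz.2.2.symm .nil))).trans (by simp)

theorem boundarySphere_le {apex : Finset (Fin 20) → Fin 20}
    (h : ∀ F, IsFacet F → apex F ∈ F) : boundarySphere apex ≤ vietorisRips graph 2 := by
  rintro s ⟨hs, F, hF, x, hx, y, hy, _, hsub⟩
  have hsF : s ⊆ F := hsub.trans (by
    intro z hz
    simp only [Finset.mem_insert, Finset.mem_singleton] at hz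
    rcases hz with rfl | rfl | rfl
    exacts [h F hF, hx, hy])
  exact ⟨hs, fun u hu v hv => edist_le_two_of_isFacet hF (hsF hu) (hsF hv)⟩

/-- The complex `VR_{≤ 3} \ {τ_1, …, τ_10}`. -/
def reducedVR : PreAbstractSimplicialComplex (Fin 20) :=
  removeSimplices (vietorisRips graph 3) (distanceThreeTetrahedra graph)

theorem vietorisRips_two_le : vietorisRips graph 2 ≤ reducedVR := by
  intro s hs
  refine ⟨⟨hs.1, fun x hx y hy => (hs.2 x hx y hy).trans (by norm_num)⟩, fun t ht hts => ?_⟩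
  obtain ⟨x, hx, y, hy, hxy⟩ := Finset.one_lt_card.1 (show 1 < t.card by rw [ht.1]; norm_num)
  have h := hs.2 x (hts hx) y (hts hy)
  rw [ht.2 x hx y hy hxy] at h
  exact absurd h (by norm_num)

end Dodecahedron

/-! ### Tools for homology: free faces and integer cocycles. -/

namespace SimplicialHomology

variable {V : Type*} [LinearOrder V]

/-! All the second homology groups are measured by one integer cochain, `rayCochain`, the
intersection number with a generic ray from the centre. Vertices at combinatorial distance at most 3
have inner product at least -1/3 on the unit sphere. For weights of sum 1 on at most four such
points, the squared norm of the weighted mean is at least 4/3 times the sum of the squared weights,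
minus 1/3, hence nonnegative; it vanishes only for four equal weights and all inner products -1/3.
So among the tetrahedra of diameter at most 3 exactly the ten removed ones contain the centre.
Accordingly the cochain vanishes on all boundaries in `reducedVR`
(`rayCochain_eq_zero_of_mem_boundaries`), is 1 or -1 on the boundary of each removed tetrahedron,
and is 1 on the fundamental cycle of each triangulated sphere.

It remains to see that a cycle with value 0 is a boundary. By `exists_cycle_vietorisRips_two` each
2-cycle of `reducedVR` is homologous to one of diameter 2, and by `exists_cycle_boundarySphere` each
of these is homologous to a cycle of a triangulated sphere. Both steps use
`exists_cycle_sub_mem_boundaries`: triangles are rewritten modulo boundaries until the extra ones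
have private edges, and these cannot occur in a cycle. On the sphere, a cycle is determined by its
coefficient at one triangle, so that value 0 forces the cycle to be 0
(`eq_zero_of_rayCochain_eq_zero`).

Hence the same cochain identifies all three groups with the integers, and the inclusions become the
identity. The finite facts about the dodecahedron are verified by evaluation. -/

theorem simplexBoundary_apply_erase {s : Finset V} (hs : 1 < s.card) {v : V} (hv : v ∈ s) :
    simplexBoundary s (s.erase v) = (-1) ^ (s.filter (· < v)).card := by
  rw [simplexBoundary, if_neg (by omega), Finsupp.finsetSum_apply,
    Finset.sum_eq_single_of_mem v hv, Finsupp.single_eq_same]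
  intro w hw hwv
  refine Finsupp.single_eq_of_ne fun h => hwv ?_
  by_contra hne
  have : w ∈ s.erase v := Finset.mem_erase.2 ⟨hne, hw⟩
  rw [h] at this
  exact (Finset.mem_erase.1 this).1 rfl

theorem exists_erase_of_simplexBoundary_apply_ne_zero {s e : Finset V}
    (h : simplexBoundary s e ≠ 0) : ∃ v ∈ s, e = s.erase v := by
  by_contra! hne
  refine h ?_
  rw [simplexBoundary]
  split_ifs
  · rfl
  · rw [Finsupp.finsetSum_apply]
    exact Finset.sum_eq_zero fun v hv => Finsupp.single_eq_of_ne (hne v hv)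

theorem boundary_apply (z : Finset V →₀ ℤ) (e : Finset V) :
    boundary z e = z.sum fun s a => a * simplexBoundary s e := by
  rw [boundary, Finsupp.linearCombination_apply, Finsupp.sum_apply]
  rfl

/-- If a facet `s \ {v}` of `s` lies in no other simplex of a cycle `z`, then `s` does not occur
in `z`. -/
theorem apply_eq_zero_of_boundary_eq_zero {z : Finset V →₀ ℤ} (hz : boundary z = 0)
    {s : Finset V} (hs : 1 < s.card) {v : V} (hv : v ∈ s)
    (h : ∀ t, z t ≠ 0 → t.card = s.card → s.erase v ⊆ t → t = s) : z s = 0 := by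
  have h0 := boundary_apply z (s.erase v)
  -- The sum is extended to include `s`, which may lie outside the support; all terms other than
  -- that of `s` vanish.
  rw [hz, Finsupp.zero_apply, Finsupp.sum_of_support_subset z
    (Finset.subset_insert s z.support) _ (by simp),
    Finset.sum_eq_single_of_mem s (Finset.mem_insert_self _ _),
    simplexBoundary_apply_erase hs hv] at h0
  · rcases mul_eq_zero.1 h0.symm with h1 | h1
    · exact h1
    · exact absurd h1 (pow_ne_zero _ (by norm_num))
  · intro t _ hts
    by_contra hne
    obtain ⟨hzt, hbt⟩ := mul_ne_zero_iff.1 hne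
    obtain ⟨w, hw, he⟩ := exists_erase_of_simplexBoundary_apply_ne_zero hbt
    have hc := congrArg Finset.card he
    rw [Finset.card_erase_of_mem hv, Finset.card_erase_of_mem hw] at hc
    have := Finset.card_pos.2 ⟨w, hw⟩
    exact hts (h t hzt (by omega) (he ▸ Finset.erase_subset _ _))

/-- Modulo boundaries, a facet of a simplex is a combination of the other facets. -/
theorem single_erase_mem {K : PreAbstractSimplicialComplex V} {n : ℕ}
    {M : Submodule ℤ (Finset V →₀ ℤ)} (hM : boundaries K n ≤ M) {s : Finset V}
    (hs : s ∈ K.faces) (hc : s.card = n + 2) {v : V} (hv : v ∈ s)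
    (h : ∀ u ∈ s, u ≠ v → Finsupp.single (s.erase u) 1 ∈ M) :
    Finsupp.single (s.erase v) 1 ∈ M := by
  have hb : simplexBoundary s ∈ M := by
    refine hM ⟨Finsupp.single s 1, Finsupp.single_mem_supported ℤ _ ⟨hs, hc⟩, ?_⟩
    rw [boundary_single, one_smul]
  rw [simplexBoundary, if_neg (by omega), ← Finset.add_sum_erase _ _ hv] at hb
  have h1 := (Submodule.add_mem_iff_left M (Submodule.sum_mem M fun u hu => ?_)).1 hb
  · have h2 := M.smul_mem ((-1) ^ (s.filter (· < v)).card) h1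
    rwa [Finsupp.smul_single, smul_eq_mul, ← mul_pow, neg_one_mul, neg_neg, one_pow] at h2
  · rw [Finset.mem_erase] at hu
    have := M.smul_mem ((-1) ^ (s.filter (· < u)).card) (h u hu.2 hu.1)
    rwa [Finsupp.smul_single, smul_eq_mul, mul_one] at this

/-- Let `L` be a subcomplex of `K` and `B` a set of `n`-simplices such that, modulo boundaries,
each `n`-simplex of `K` is a combination of simplices of `L` and `B`. If each simplex in `B` has a
facet that lies in no other simplex of `L` and `B`, then every `n`-cycle of `K` is homologous to a
cycle of `L`. -/
theorem exists_cycle_sub_mem_boundaries {K L : PreAbstractSimplicialComplex V} {n : ℕ}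
    (hn : 0 < n) (B : Set (Finset V))
    (hgen : ∀ s ∈ K.faces, s.card = n + 1 → Finsupp.single s 1 ∈
      boundaries K n ⊔ Finsupp.supported ℤ ℤ {t | t.card = n + 1 ∧ (t ∈ L.faces ∨ t ∈ B)})
    (hfree : ∀ s ∈ B, s ∉ L.faces → ∃ v ∈ s, ∀ t, t.card = n + 1 → (t ∈ L.faces ∨ t ∈ B) →
      s.erase v ⊆ t → t = s)
    {z : Finset V →₀ ℤ} (hz : z ∈ cycles K n) :
    ∃ y ∈ cycles L n, z - y ∈ boundaries K n := by
  have hmem : z ∈ boundaries K n ⊔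
      Finsupp.supported ℤ ℤ {t | t.card = n + 1 ∧ (t ∈ L.faces ∨ t ∈ B)} := by
    rw [← Finsupp.sum_single z]
    refine Submodule.sum_mem _ fun s hs => ?_
    obtain ⟨hsK, hc⟩ := (Finsupp.mem_supported ℤ z).1 hz.1 hs
    have := Submodule.smul_mem _ (z s) (hgen s hsK hc)
    rwa [Finsupp.smul_single, smul_eq_mul, mul_one] at this
  obtain ⟨b, hb, y, hy, rfl⟩ := Submodule.mem_sup.1 hmem
  have hy0 : boundary y = 0 := by
    have h1 : boundary (b + y) = 0 := hz.2
    have h2 : boundary b = 0 := (boundaries_le_cycles K n hb).2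
    rwa [map_add, h2, zero_add] at h1
  refine ⟨y, ⟨?_, hy0⟩, by simpa using hb⟩
  refine (Finsupp.mem_supported ℤ y).2 fun s hs => ?_
  have hys := (Finsupp.mem_supported ℤ y).1 hy
  obtain ⟨hc, hsL⟩ := hys hs
  refine ⟨by_contra fun hsL' => Finsupp.mem_support_iff.1 hs ?_, hc⟩
  obtain ⟨v, hv, h⟩ := hfree s (hsL.resolve_left hsL') hsL'
  exact apply_eq_zero_of_boundary_eq_zero hy0 (by omega) hv fun t ht htc hst =>
    h t (htc.trans hc) (hys (Finsupp.mem_support_iff.2 ht)).2 hst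

/-- A cochain that vanishes on boundaries, takes the value `1` on some cycle and vanishes on no
cycle that is not a boundary identifies the homology group with `ℤ`. -/
theorem exists_homology_equiv {K : PreAbstractSimplicialComplex V} {n : ℕ}
    (f : (Finset V →₀ ℤ) →ₗ[ℤ] ℤ) (hf : ∀ b ∈ boundaries K n, f b = 0)
    (hg : ∃ g ∈ cycles K n, f g = 1) (hker : ∀ z ∈ cycles K n, f z = 0 → z ∈ boundaries K n) :
    ∃ e : Homology K n ≃ₗ[ℤ] ℤ, ∀ z hz, e (homologyClass K n z hz) = f z := by
  let φ : Homology K n →ₗ[ℤ] ℤ :=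
    Submodule.liftQ _ (f ∘ₗ (cycles K n).subtype) fun z hz => hf z hz
  have hφ : ∀ z hz, φ (homologyClass K n z hz) = f z := fun z hz => rfl
  refine ⟨LinearEquiv.ofBijective φ ⟨?_, ?_⟩, hφ⟩
  · refine (injective_iff_map_eq_zero φ).2 fun x hx => ?_
    obtain ⟨⟨z, hz⟩, rfl⟩ := Submodule.Quotient.mk_surjective _ x
    exact (Submodule.Quotient.mk_eq_zero _).2 (hker z hz hx)
  · intro m
    obtain ⟨g, hg, h1⟩ := hg
    refine ⟨m • homologyClass K n g hg, ?_⟩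
    rw [map_smul, hφ, h1, smul_eq_mul, mul_one]

/-- Both groups are identified with the integers by the same cochain, so the inclusion becomes the
identity of the integers. -/
theorem homologyMap_bijective {K L : PreAbstractSimplicialComplex V} (h : K ≤ L) {n : ℕ}
    {f : (Finset V →₀ ℤ) →ₗ[ℤ] ℤ} {eK : Homology K n ≃ₗ[ℤ] ℤ} {eL : Homology L n ≃ₗ[ℤ] ℤ}
    (hK : ∀ z hz, eK (homologyClass K n z hz) = f z)
    (hL : ∀ z hz, eL (homologyClass L n z hz) = f z) :
    Function.Bijective (homologyMap h n) := by
  have hcomp : ⇑(homologyMap h n) = eL.symm ∘ eK := by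
    funext x
    obtain ⟨⟨z, hz⟩, rfl⟩ := Submodule.Quotient.mk_surjective _ x
    refine (eL.symm_apply_eq.2 ?_).symm
    exact (hK z hz).trans (hL z (cycles_mono h n hz)).symm
  rw [hcomp]
  exact eL.symm.bijective.comp eK.bijective

theorem span_homologyClass_eq_top {K : PreAbstractSimplicialComplex V} {n : ℕ}
    {f : (Finset V →₀ ℤ) →ₗ[ℤ] ℤ} {e : Homology K n ≃ₗ[ℤ] ℤ}
    (he : ∀ z hz, e (homologyClass K n z hz) = f z) {z : Finset V →₀ ℤ} (hz : z ∈ cycles K n)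
    (h : IsUnit (f z)) : Submodule.span ℤ {homologyClass K n z hz} = ⊤ := by
  -- A unit of the integers is its own inverse, hence the coefficient `e x * f z`.
  refine Submodule.eq_top_iff'.2 fun x => Submodule.mem_span_singleton.2 ⟨e x * f z, ?_⟩
  refine e.injective ?_
  rw [map_smul, he, smul_eq_mul, mul_assoc, Int.isUnit_mul_self h, mul_one]

/-! ### Oriented simplices -/

/-- The sign of the ordered pair `(x, y)`. -/
def orient (x y : V) : ℤ := if x < y then 1 else -1

theorem orient_swap {x y : V} (h : x ≠ y) : orient y x = -orient x y := by
  unfold orient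
  rcases lt_or_gt_of_ne h with h | h <;> simp [h, h.not_gt]

/-- The edge from `x` to `y`. -/
noncomputable def orientedEdge (x y : V) : Finset V →₀ ℤ := Finsupp.single {x, y} (orient x y)

/-- The triangle `{x, y, z}`, oriented by the order `x, y, z` of its vertices. -/
noncomputable def orientedTriangle (x y z : V) : Finset V →₀ ℤ :=
  Finsupp.single {x, y, z} (orient x y * orient x z * orient y z)

theorem orientedEdge_swap {x y : V} (h : x ≠ y) : orientedEdge y x = -orientedEdge x y := by
  rw [orientedEdge, orientedEdge, orient_swap h, Finset.pair_comm, Finsupp.single_neg]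

theorem orientedTriangle_swap_left {x y z : V} (h : x ≠ y) :
    orientedTriangle y x z = -orientedTriangle x y z := by
  rw [orientedTriangle, orientedTriangle, orient_swap h, Finset.insert_comm, ← Finsupp.single_neg]
  congr 1
  ring

theorem orientedTriangle_swap_right {x y z : V} (h : y ≠ z) :
    orientedTriangle x z y = -orientedTriangle x y z := by
  rw [orientedTriangle, orientedTriangle, orient_swap h, Finset.pair_comm, ← Finsupp.single_neg]
  congr 1
  ring

theorem simplexBoundary_of_lt_of_lt {x y z : V} (hxy : x < y) (hyz : y < z) :
    simplexBoundary {x, y, z} =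
      Finsupp.single {y, z} 1 - Finsupp.single {x, z} 1 + Finsupp.single {x, y} 1 := by
  have hxz := hxy.trans hyz
  have hc : ({x, y, z} : Finset V).card = 3 :=
    Finset.card_eq_three.2 ⟨x, y, z, hxy.ne, hxz.ne, hyz.ne, rfl⟩
  have e1 : ({x, y, z} : Finset V).erase x = {y, z} := by grind
  have e2 : ({x, y, z} : Finset V).erase y = {x, z} := by grind
  have e3 : ({x, y, z} : Finset V).erase z = {x, y} := by grind
  have f1 : ({x, y, z} : Finset V).filter (· < x) = ∅ := by grind
  have f2 : ({x, y, z} : Finset V).filter (· < y) = {x} := by grind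
  have f3 : ({x, y, z} : Finset V).filter (· < z) = {x, y} := by grind
  rw [simplexBoundary, if_neg (by omega), Finset.sum_insert (by grind),
    Finset.sum_insert (by grind), Finset.sum_singleton, e1, e2, e3, f1, f2, f3,
    Finset.card_pair hxy.ne]
  simp [sub_eq_add_neg, add_assoc]

theorem boundary_orientedTriangle_of_lt_of_lt {x y z : V} (hxy : x < y) (hyz : y < z) :
    boundary (orientedTriangle x y z) =
      orientedEdge x y + orientedEdge y z + orientedEdge z x := by
  rw [orientedEdge_swap (hxy.trans hyz).ne, orientedTriangle, boundary_single,
    simplexBoundary_of_lt_of_lt hxy hyz]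
  simp only [orientedEdge, orient, hxy, hyz, hxy.trans hyz, if_true, mul_one, one_smul]
  abel

/-- Both sides change sign under a transposition of the vertices, so each order reduces to the
increasing one. Two of the eight sign patterns are cyclic and hence impossible. -/
theorem boundary_orientedTriangle {x y z : V} (hxy : x ≠ y) (hxz : x ≠ z) (hyz : y ≠ z) :
    boundary (orientedTriangle x y z) =
      orientedEdge x y + orientedEdge y z + orientedEdge z x := by
  rcases lt_or_gt_of_ne hxy with h1 | h1 <;> rcases lt_or_gt_of_ne hxz with h2 | h2 <;>
    rcases lt_or_gt_of_ne hyz with h3 | h3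
  · exact boundary_orientedTriangle_of_lt_of_lt h1 h3
  · rw [orientedTriangle_swap_right h3.ne, map_neg, boundary_orientedTriangle_of_lt_of_lt h2 h3,
      orientedEdge_swap h1.ne', orientedEdge_swap h2.ne', orientedEdge_swap h3.ne']
    abel
  · exact absurd (h1.trans h3) h2.not_gt
  · rw [orientedTriangle_swap_right h3.ne, orientedTriangle_swap_left h2.ne, neg_neg,
      boundary_orientedTriangle_of_lt_of_lt h2 h1]
    abel
  · rw [orientedTriangle_swap_left h1.ne, map_neg, boundary_orientedTriangle_of_lt_of_lt h1 h2,
      orientedEdge_swap h1.ne', orientedEdge_swap h2.ne', orientedEdge_swap h3.ne']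
    abel
  · exact absurd (h3.trans h1) h2.not_gt
  · rw [orientedTriangle_swap_left h1.ne, orientedTriangle_swap_right h2.ne, neg_neg,
      boundary_orientedTriangle_of_lt_of_lt h3 h2]
    abel
  · rw [orientedTriangle_swap_left h1.ne, orientedTriangle_swap_right h2.ne,
      orientedTriangle_swap_left h3.ne, neg_neg, map_neg,
      boundary_orientedTriangle_of_lt_of_lt h3 h1,
      orientedEdge_swap h1.ne', orientedEdge_swap h2.ne', orientedEdge_swap h3.ne']
    abel

/-- The fan of triangles with apex `a` over the path `b, c, d, e` has as boundary the pentagon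
`a, b, c, d, e`. -/
theorem boundary_fan {a b c d e : V} (h : [a, b, c, d, e].Nodup) :
    boundary (orientedTriangle a b c + orientedTriangle a c d + orientedTriangle a d e) =
      orientedEdge a b + orientedEdge b c + orientedEdge c d + orientedEdge d e +
        orientedEdge e a := by
  simp only [List.nodup_cons, List.mem_cons, List.not_mem_nil, not_or, or_false] at h
  obtain ⟨⟨ab, ac, ad, ae⟩, ⟨bc, bd, be⟩, ⟨cd, ce⟩, de, -⟩ := h
  rw [map_add, map_add, boundary_orientedTriangle ab ac bc, boundary_orientedTriangle ac ad cd,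
    boundary_orientedTriangle ad ae de, orientedEdge_swap ac, orientedEdge_swap ad]
  abel

/-! ### Cochains -/

/-- The value of a cochain on the boundary of a tetrahedron. -/
theorem linearCombination_simplexBoundary_of_lt (F : Finset V → ℤ) {a b c d : V} (hab : a < b)
    (hbc : b < c) (hcd : c < d) :
    Finsupp.linearCombination ℤ F (simplexBoundary {a, b, c, d}) =
      F {b, c, d} - F {a, c, d} + F {a, b, d} - F {a, b, c} := by
  have hac := hab.trans hbc
  have hbd := hbc.trans hcd
  have had := hab.trans hbd
  have hc : ({a, b, c, d} : Finset V).card = 4 :=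
    Finset.card_eq_four.2 ⟨a, b, c, d, hab.ne, hac.ne, had.ne, hbc.ne, hbd.ne, hcd.ne, rfl⟩
  have e1 : ({a, b, c, d} : Finset V).erase a = {b, c, d} := by grind
  have e2 : ({a, b, c, d} : Finset V).erase b = {a, c, d} := by grind
  have e3 : ({a, b, c, d} : Finset V).erase c = {a, b, d} := by grind
  have e4 : ({a, b, c, d} : Finset V).erase d = {a, b, c} := by grind
  have f1 : ({a, b, c, d} : Finset V).filter (· < a) = ∅ := by grind
  have f2 : ({a, b, c, d} : Finset V).filter (· < b) = {a} := by grind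
  have f3 : ({a, b, c, d} : Finset V).filter (· < c) = {a, b} := by grind
  have f4 : ({a, b, c, d} : Finset V).filter (· < d) = {a, b, c} := by grind
  rw [simplexBoundary, if_neg (by omega), Finset.sum_insert (by grind),
    Finset.sum_insert (by grind), Finset.sum_insert (by grind), Finset.sum_singleton, e1, e2, e3,
    e4, f1, f2, f3, f4, Finset.card_pair hab.ne,
    Finset.card_eq_three.2 ⟨a, b, c, hab.ne, hac.ne, hbc.ne, rfl⟩]
  simp only [map_add, Finsupp.linearCombination_single, smul_eq_mul, Finset.card_empty,
    Finset.card_singleton]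
  ring

theorem linearCombination_eq_zero_of_mem_boundaries {K : PreAbstractSimplicialComplex V} {n : ℕ}
    {F : Finset V → ℤ} (h : ∀ s ∈ K.faces, s.card = n + 2 →
      Finsupp.linearCombination ℤ F (simplexBoundary s) = 0) :
    ∀ b ∈ boundaries K n, Finsupp.linearCombination ℤ F b = 0 := by
  rintro _ ⟨c, hc, rfl⟩
  rw [boundary, Finsupp.linearCombination_apply ℤ c, map_finsuppSum]
  refine Finset.sum_eq_zero fun s hs => ?_
  obtain ⟨hsK, hsc⟩ := (Finsupp.mem_supported ℤ c).1 hc hs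
  simp only [map_smul, h s hsK hsc, smul_zero]

end SimplicialHomology

/-! ### Sets of three or four elements in increasing order. -/

theorem Finset.exists_lt_of_card_eq_three {V : Type*} [LinearOrder V] {s : Finset V}
    (h : s.card = 3) : ∃ a b c, a < b ∧ b < c ∧ s = {a, b, c} := by
  refine ⟨s.orderEmbOfFin h 0, s.orderEmbOfFin h 1, s.orderEmbOfFin h 2, by simp, by simp, ?_⟩
  ext x
  rw [← Finset.mem_coe, ← Finset.range_orderEmbOfFin s h, Set.mem_range, Fin.exists_fin_succ,
    Fin.exists_fin_two]
  simp [eq_comm]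

theorem Finset.exists_lt_of_card_eq_four {V : Type*} [LinearOrder V] {s : Finset V}
    (h : s.card = 4) : ∃ a b c d, a < b ∧ b < c ∧ c < d ∧ s = {a, b, c, d} := by
  refine ⟨s.orderEmbOfFin h 0, s.orderEmbOfFin h 1, s.orderEmbOfFin h 2, s.orderEmbOfFin h 3,
    by simp, by simp, by simp, ?_⟩
  ext x
  rw [← Finset.mem_coe, ← Finset.range_orderEmbOfFin s h, Set.mem_range, Fin.exists_fin_succ,
    Fin.exists_fin_succ, Fin.exists_fin_two]
  simp [eq_comm]

namespace Dodecahedron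

/-! ### Combinatorial distances -/

/-- The combinatorial distances of the vertices, as the octal digits of a number. -/
def distCode : ℕ :=
  0x10d49b4d328a71c8296d24d371c28a34449b69a4518e3a606d269a8e34514d310d49b25b4a44d38296d26c991269a34449b4a425b69aa606d29126c949b4d310d2d42d46d24d382966266249b69a34450b50b6d269aa608998992d42d42d40934dd50b2d466241a6ab2d466250b4c275350b662899690ada66250b2d44dd09389950b6626ab41a66289950b7534c2899899899ada690

/-- The combinatorial distance of two vertices. -/
def hops (x y : Fin 20) : ℕ := (distCode >>> (3 * (20 * x.val + y.val))) % 8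

theorem adj_iff_hops : ∀ x y, graph.Adj x y ↔ hops x y = 1 := by decide +kernel

theorem hops_eq_zero : ∀ {x y}, hops x y = 0 ↔ x = y := by decide +kernel

theorem hops_comm : ∀ x y, hops x y = hops y x := by decide +kernel

theorem exists_hops_add_one_eq : ∀ x y, hops x y ≠ 0 →
    ∃ z, hops x z = 1 ∧ hops z y + 1 = hops x y := by decide +kernel

theorem hops_le_add_one : ∀ x z, hops x z = 1 → ∀ y, hops x y ≤ hops z y + 1 := by
  decide +kernel

theorem edist_le_hops (n : ℕ) : ∀ x y, hops x y = n → graph.edist x y ≤ n := by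
  induction n with
  | zero =>
    intro x y h
    rw [hops_eq_zero.1 h]
    simp
  | succ n ih =>
    intro x y h
    obtain ⟨z, hxz, hzy⟩ := exists_hops_add_one_eq x y (by omega)
    have h1 : graph.edist x z ≤ 1 :=
      (SimpleGraph.edist_le ((adj_iff_hops x z).2 hxz).toWalk).trans (by simp)
    calc graph.edist x y ≤ graph.edist x z + graph.edist z y := SimpleGraph.edist_triangle
      _ ≤ 1 + n := add_le_add h1 (ih z y (by omega))
      _ = ↑(n + 1) := by push_cast; rw [add_comm]

theorem hops_le_length {x y : Fin 20} (p : graph.Walk x y) : hops x y ≤ p.length := by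
  induction p with
  | nil => exact (hops_eq_zero.2 rfl).le
  | cons h p ih =>
    rw [SimpleGraph.Walk.length_cons]
    exact (hops_le_add_one _ _ ((adj_iff_hops _ _).1 h) _).trans (by omega)

/-- A table that is zero exactly on the diagonal is the distance if each positive entry drops by one
at some neighbour (upper bound) and no step along an edge lowers it by more than one (lower bound).
-/
theorem edist_eq_hops (x y : Fin 20) : graph.edist x y = hops x y :=
  le_antisymm (edist_le_hops _ x y rfl)
    (le_iInf fun p => by exact_mod_cast hops_le_length p)

theorem mem_vietorisRips_iff {r : ℕ} {s : Finset (Fin 20)} :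
    s ∈ (vietorisRips graph r).faces ↔ s.Nonempty ∧ ∀ x ∈ s, ∀ y ∈ s, hops x y ≤ r := by
  simp only [vietorisRips, Set.mem_ofPred_eq, edist_eq_hops, Nat.cast_le]

theorem mem_distanceThreeTetrahedra_iff {s : Finset (Fin 20)} :
    s ∈ distanceThreeTetrahedra graph ↔
      s.card = 4 ∧ ∀ x ∈ s, ∀ y ∈ s, x ≠ y → hops x y = 3 := by
  simp only [distanceThreeTetrahedra, Set.mem_ofPred_eq, edist_eq_hops]
  norm_cast

/-! ### The tetrahedra -/

/-- The vertices of the ten regular tetrahedra with edges of combinatorial length `3`. -/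
def tetraVertex : Fin 10 → Fin 4 → Fin 20 :=
  ![![0, 3, 5, 6], ![0, 9, 13, 17], ![1, 2, 4, 7], ![1, 8, 13, 19], ![2, 11, 12, 17],
    ![3, 10, 12, 19], ![4, 9, 15, 16], ![5, 8, 15, 18], ![6, 11, 14, 16], ![7, 10, 14, 18]]

/-- The conditions on each vertex directly follow its quantifier, so that the exhaustive search
discards partial tuples early. The later searches have the same form. -/
theorem exists_tetraVertex_of_lt : ∀ a b, a < b → hops a b = 3 →
    ∀ c, b < c → hops a c = 3 ∧ hops b c = 3 →
    ∀ d, c < d → hops a d = 3 ∧ hops b d = 3 ∧ hops c d = 3 →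
    ∃ i, tetraVertex i = ![a, b, c, d] := by
  decide +kernel

theorem hops_tetraVertex : ∀ i m n, m ≠ n → hops (tetraVertex i m) (tetraVertex i n) = 3 := by
  decide +kernel

theorem tetraVertex_injective : ∀ i, Function.Injective (tetraVertex i) := by
  intro i m n h
  by_contra hmn
  have := hops_tetraVertex i m n hmn
  rw [hops_eq_zero.2 h] at this
  omega

theorem eq_of_forall_tetraVertex : ∀ i j, (∀ m, ∃ n, tetraVertex j n = tetraVertex i m) →
    i = j := by
  decide +kernel

/-- This is the maximality of the ten tetrahedra: a vertex outside one of them is at distance more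
than 3 from one of its corners. -/
theorem exists_tetraVertex_of_forall_hops_le : ∀ i v,
    (∀ m, hops (tetraVertex i m) v ≤ 3) → ∃ m, tetraVertex i m = v := by
  decide +kernel

theorem distanceThreeTetrahedra_eq : distanceThreeTetrahedra graph =
    Set.range fun i => Finset.univ.image (tetraVertex i) := by
  ext s
  rw [mem_distanceThreeTetrahedra_iff, Set.mem_range]
  constructor
  · rintro ⟨hc, h⟩
    obtain ⟨a, b, c, d, hab, hbc, hcd, rfl⟩ := Finset.exists_lt_of_card_eq_four hc
    have hac := hab.trans hbc
    have hbd := hbc.trans hcd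
    have had := hab.trans hbd
    obtain ⟨i, hi⟩ := exists_tetraVertex_of_lt a b hab
      (h a (by simp) b (by simp) hab.ne) c hbc
      ⟨h a (by simp) c (by simp) hac.ne, h b (by simp) c (by simp) hbc.ne⟩ d hcd
      ⟨h a (by simp) d (by simp) had.ne, h b (by simp) d (by simp) hbd.ne,
        h c (by simp) d (by simp) hcd.ne⟩
    refine ⟨i, ?_⟩
    ext x
    simp [hi, Fin.exists_fin_succ, eq_comm]
  · rintro ⟨i, rfl⟩
    refine ⟨by rw [Finset.card_image_of_injective _ (tetraVertex_injective i)]; rfl, ?_⟩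
    intro x hx y hy hxy
    obtain ⟨m, -, rfl⟩ := Finset.mem_image.1 hx
    obtain ⟨n, -, rfl⟩ := Finset.mem_image.1 hy
    exact hops_tetraVertex i m n fun h => hxy (h ▸ rfl)

theorem ncard_distanceThreeTetrahedra : (distanceThreeTetrahedra graph).ncard = 10 := by
  rw [distanceThreeTetrahedra_eq, ← Set.image_univ, Set.ncard_image_of_injective, Set.ncard_univ,
    Nat.card_fin]
  intro i j h
  refine eq_of_forall_tetraVertex i j fun m => ?_
  have hm : tetraVertex i m ∈ Finset.univ.image (tetraVertex j) :=
    h.subset <| Finset.mem_image_of_mem _ (Finset.mem_univ m)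
  obtain ⟨n, -, hn⟩ := Finset.mem_image.1 hm
  exact ⟨n, hn⟩

theorem eq_of_mem_distanceThreeTetrahedra {s t : Finset (Fin 20)}
    (ht : t ∈ distanceThreeTetrahedra graph) (hs : s ∈ (vietorisRips graph 3).faces)
    (hts : t ⊆ s) : s = t := by
  rw [distanceThreeTetrahedra_eq] at ht
  obtain ⟨i, rfl⟩ := ht
  refine Finset.Subset.antisymm (fun v hv => ?_) hts
  obtain ⟨m, hm⟩ := exists_tetraVertex_of_forall_hops_le i v fun m =>
    (mem_vietorisRips_iff.1 hs).2 _ (hts (Finset.mem_image_of_mem _ (Finset.mem_univ m))) v hv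
  exact Finset.mem_image.2 ⟨m, Finset.mem_univ m, hm⟩

theorem faces_reducedVR :
    reducedVR.faces = (vietorisRips graph 3).faces \ distanceThreeTetrahedra graph := by
  ext s
  refine ⟨fun h => ⟨h.1, fun hs => h.2 s hs subset_rfl⟩, fun h => ⟨h.1, fun t ht hts => h.2 ?_⟩⟩
  rwa [eq_of_mem_distanceThreeTetrahedra ht h.1 hts]

/-! ### The facets -/

/-- The vertices of the facets, in counterclockwise order. -/
def corner : Fin 12 → Fin 5 → Fin 20 :=
  ![![0, 16, 18, 1, 12], ![0, 8, 10, 2, 16], ![0, 12, 14, 4, 8], ![1, 18, 3, 11, 9],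
    ![1, 9, 5, 14, 12], ![2, 13, 3, 18, 16], ![2, 10, 6, 15, 13], ![3, 13, 15, 7, 11],
    ![4, 14, 5, 19, 17], ![4, 17, 6, 10, 8], ![5, 9, 11, 7, 19], ![6, 17, 19, 7, 15]]

/-- The vertex set of a facet. -/
def facet (i : Fin 12) : Finset (Fin 20) := Finset.univ.image (corner i)

theorem corner_injective : ∀ i m n, corner i m = corner i n → m = n := by decide +kernel

theorem card_filter_hops_corner : ∀ i m,
    (Finset.univ.filter fun n => hops (corner i m) (corner i n) = 1).card = 2 := by
  decide +kernel

theorem isFacet_facet (i : Fin 12) : IsFacet (facet i) := by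
  refine ⟨Finset.card_image_of_injective _ fun m n => corner_injective i m n, fun x hx => ?_⟩
  obtain ⟨m, -, rfl⟩ := Finset.mem_image.1 hx
  rw [facet, Finset.filter_image,
    Finset.card_image_of_injective _ fun m n => corner_injective i m n,
    ← card_filter_hops_corner i m]
  simp only [adj_iff_hops]

theorem corner_mem_facet (i : Fin 12) (m : Fin 5) : corner i m ∈ facet i :=
  Finset.mem_image_of_mem _ (Finset.mem_univ m)

theorem hops_corner_succ : ∀ i m, hops (corner i m) (corner i (m + 1)) = 1 := by decide +kernel

theorem eq_add_one_of_hops_corner : ∀ i m n, hops (corner i m) (corner i n) = 1 →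
    n = m + 1 ∨ m = n + 1 := by decide +kernel

theorem hops_ne_of_hops_eq_one : ∀ x y, hops x y = 1 → ∀ z, hops y z = 1 → hops x z ≠ 1 := by
  decide +kernel

theorem eq_of_hops_four_cycle : ∀ x y, hops x y = 1 → ∀ u, hops y u = 1 → x ≠ u →
    ∀ z, hops x z = 1 → hops z u = 1 → y = z := by
  decide +kernel

theorem exists_facet_of_five_cycle : ∀ x y, hops x y = 1 → ∀ z, hops x z = 1 → y ≠ z →
    ∀ u, hops y u = 1 → u ≠ x → ∀ v, hops z v = 1 → v ≠ x → hops u v = 1 →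
    ∃ i, ∀ m, corner i m ∈ [x, y, z, u, v] := by
  decide +kernel

/-- The edge graph has no cycles of length 3 or 4, so a 2-regular set of five vertices must be one
5-cycle `x, y, u, v, z`, and every 5-cycle of the graph bounds a facet. -/
theorem exists_eq_facet {F : Finset (Fin 20)} (hF : IsFacet F) : ∃ i, F = facet i := by
  have h2 : ∀ x ∈ F, ∃ y z, y ≠ z ∧ ∀ w, w ∈ F ∧ hops x w = 1 ↔ w = y ∨ w = z := by
    intro x hx
    obtain ⟨y, z, hyz, h⟩ := Finset.card_eq_two.1 (hF.2 x hx)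
    refine ⟨y, z, hyz, fun w => ?_⟩
    rw [← adj_iff_hops, ← Finset.mem_filter, h, Finset.mem_insert, Finset.mem_singleton]
  have hother : ∀ x ∈ F, ∀ y ∈ F, hops x y = 1 →
      ∃ z ∈ F, hops x z = 1 ∧ z ≠ y ∧ ∀ w ∈ F, hops x w = 1 → w = y ∨ w = z := by
    intro x hx y hy hxy
    obtain ⟨p, q, hpq, h⟩ := h2 x hx
    rcases (h y).1 ⟨hy, hxy⟩ with rfl | rfl
    · exact ⟨q, ((h q).2 (.inr rfl)).1, ((h q).2 (.inr rfl)).2, hpq.symm,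
        fun w hw hxw => (h w).1 ⟨hw, hxw⟩⟩
    · exact ⟨p, ((h p).2 (.inl rfl)).1, ((h p).2 (.inl rfl)).2, hpq,
        fun w hw hxw => ((h w).1 ⟨hw, hxw⟩).symm⟩
  obtain ⟨x, hx⟩ := Finset.card_pos.1 (show 0 < F.card by rw [hF.1]; norm_num)
  obtain ⟨y, z, hyz, hxw⟩ := h2 x hx
  obtain ⟨hy, hxy⟩ := (hxw y).2 (.inl rfl)
  obtain ⟨hz, hxz⟩ := (hxw z).2 (.inr rfl)
  obtain ⟨u, hu, hyu, hux, hyw⟩ := hother y hy x hx (hops_comm x y ▸ hxy)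
  obtain ⟨v, hv, hzv, hvx, hzw⟩ := hother z hz x hx (hops_comm x z ▸ hxz)
  have huz : u ≠ z := by
    rintro rfl
    exact hops_ne_of_hops_eq_one x y hxy u hyu hxz
  have hzu : hops z u ≠ 1 := fun h => hyz (eq_of_hops_four_cycle x y hxy u hyu hux.symm z hxz h)
  have huv : hops u v = 1 := by
    obtain ⟨w, hw, huw, hwy, -⟩ := hother u hu y hy (hops_comm y u ▸ hyu)
    suffices w = v from this ▸ huw
    -- Otherwise `w` would be a sixth element of `F`, distinct from `x, y, z, u, v`.
    by_contra hwv
    have hwx : w ≠ x := by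
      rintro rfl
      rcases (hxw u).1 ⟨hu, hops_comm u w ▸ huw⟩ with rfl | rfl
      · rw [hops_eq_zero.2 rfl] at hyu; omega
      · exact huz rfl
    have hwz : w ≠ z := by
      rintro rfl
      exact hzu (hops_comm u w ▸ huw)
    have hwu : w ≠ u := by
      rintro rfl
      rw [hops_eq_zero.2 rfl] at huw; omega
    have hne : ∀ {a b}, hops a b = 1 → a ≠ b := by
      rintro a _ h rfl
      rw [hops_eq_zero.2 rfl] at h; omega
    have hvy : v ≠ y := by
      rintro rfl
      exact hops_ne_of_hops_eq_one x z hxz v hzv hxy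
    have hvu : v ≠ u := fun h => hzu (h ▸ hzv)
    have hc : ({x, y, z, u, v, w} : Finset (Fin 20)).card ≤ F.card :=
      Finset.card_le_card (by
        intro a ha
        simp only [Finset.mem_insert, Finset.mem_singleton] at ha
        rcases ha with rfl | rfl | rfl | rfl | rfl | rfl <;> assumption)
    rw [hF.1, Finset.card_insert_of_notMem, Finset.card_insert_of_notMem,
      Finset.card_insert_of_notMem, Finset.card_insert_of_notMem, Finset.card_pair] at hc
    · omega
    · exact Ne.symm hwv
    · simp [hvu.symm, hwu.symm]
    · simp [huz.symm, hne hzv, hwz.symm]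
    · simp [hyz, hne hyu, hvy.symm, hwy.symm]
    · simp [hne hxy, hne hxz, hux.symm, hvx.symm, hwx.symm]
  obtain ⟨i, hi⟩ := exists_facet_of_five_cycle x y hxy z hxz hyz u hyu hux v hzv hvx huv
  refine ⟨i, (Finset.eq_of_subset_of_card_le (fun a ha => ?_) ?_).symm⟩
  · obtain ⟨m, -, rfl⟩ := Finset.mem_image.1 ha
    have := hi m
    simp only [List.mem_cons, List.not_mem_nil, or_false] at this
    rcases this with h | h | h | h | h <;> rw [h] <;> assumption
  · rw [hF.1, (isFacet_facet i).1]

theorem isFacet_iff {F : Finset (Fin 20)} : IsFacet F ↔ ∃ i, F = facet i :=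
  ⟨exists_eq_facet, fun ⟨i, hi⟩ => hi ▸ isFacet_facet i⟩

end Dodecahedron

theorem Finset.exists_mem_erase_of_ne {V : Type*} [DecidableEq V] {s : Finset V}
    (hs : 2 < s.card) {x y : V} (hx : x ∈ s) (hy : y ∈ s) :
    ∃ v ∈ s, x ∈ s.erase v ∧ y ∈ s.erase v := by
  obtain ⟨v, hv, hxy⟩ := Finset.exists_mem_notMem_of_card_lt_card
    ((Finset.card_le_two (a := x) (b := y)).trans_lt hs)
  simp only [Finset.mem_insert, Finset.mem_singleton, not_or] at hxy
  exact ⟨v, hv, Finset.mem_erase.2 ⟨Ne.symm hxy.1, hx⟩, Finset.mem_erase.2 ⟨Ne.symm hxy.2, hy⟩⟩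

namespace Dodecahedron

open SimplicialHomology

/-! ### A cochain that counts the intersections with a ray -/

/-- The number with binary digits `1` at the elements of a vertex set. -/
def vertexCode (s : Finset (Fin 20)) : ℕ := ∑ v ∈ s, 2 ^ v.val

/-- The sign with which a generic ray from the centre of the dodecahedron meets a triangle with
edges of combinatorial length at most `3`, given by its code and oriented by the increasing order
of its vertices. -/
def raySign (m : ℕ) : ℤ :=
  if m ∈ [19, 97, 289, 131105, 131585, 135169, 147457, 274, 65554, 290, 135172, 4368, 5136, 4384,
      262432, 20736, 135424, 528640, 21504, 136192, 529408] then 1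
  else if m ∈ [49, 529, 4113, 16401, 16449, 16641, 17409, 22, 16642, 524546, 4116, 66064, 69648,
      81936, 81984, 82176, 278784, 82944, 279552] then -1
  else 0

/-- The intersection number of chains with a generic ray from the centre. -/
noncomputable def rayCochain : (Finset (Fin 20) →₀ ℤ) →ₗ[ℤ] ℤ :=
  Finsupp.linearCombination ℤ fun s => raySign (vertexCode s)

/-- The intersection number of the ray with a triangle with vertices in increasing order. -/
def rayTriangle (x y z : Fin 20) : ℤ := raySign (2 ^ x.val + 2 ^ y.val + 2 ^ z.val)

theorem raySign_vertexCode {x y z : Fin 20} (hxy : x ≠ y) (hxz : x ≠ z) (hyz : y ≠ z) :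
    raySign (vertexCode {x, y, z}) = rayTriangle x y z := by
  rw [rayTriangle, vertexCode, Finset.sum_insert (by simp [hxy, hxz]), Finset.sum_pair hyz,
    add_assoc]

theorem rayCochain_orientedTriangle {x y z : Fin 20} (hxy : x ≠ y) (hxz : x ≠ z) (hyz : y ≠ z) :
    rayCochain (orientedTriangle x y z) =
      orient x y * orient x z * orient y z * rayTriangle x y z := by
  rw [rayCochain, orientedTriangle, Finsupp.linearCombination_single,
    raySign_vertexCode hxy hxz hyz, smul_eq_mul]

/-- The intersection number of the ray with the boundary of a tetrahedron. -/
def rayTetrahedron (a b c d : Fin 20) : ℤ :=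
  rayTriangle b c d - rayTriangle a c d + rayTriangle a b d - rayTriangle a b c

theorem rayCochain_simplexBoundary {a b c d : Fin 20} (hab : a < b) (hbc : b < c) (hcd : c < d) :
    rayCochain (simplexBoundary {a, b, c, d}) = rayTetrahedron a b c d := by
  have hac := hab.trans hbc
  have hbd := hbc.trans hcd
  have had := hab.trans hbd
  rw [rayCochain, linearCombination_simplexBoundary_of_lt _ hab hbc hcd,
    raySign_vertexCode hab.ne hac.ne hbc.ne, raySign_vertexCode hab.ne had.ne hbd.ne,
    raySign_vertexCode hac.ne had.ne hcd.ne, raySign_vertexCode hbc.ne hbd.ne hcd.ne,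
    rayTetrahedron]

/-- The cocycle property: a tetrahedron of diameter at most 3 that does not have all edges of length
3 misses the centre, so the ray enters it as often as it leaves. The geometric meaning of `raySign`
is not used; finite checks such as this one replace it. -/
theorem rayTetrahedron_eq_zero : ∀ a b, a < b → hops a b ≤ 3 →
    ∀ c, b < c → hops a c ≤ 3 ∧ hops b c ≤ 3 →
    ∀ d, c < d → hops a d ≤ 3 ∧ hops b d ≤ 3 ∧ hops c d ≤ 3 →
    rayTetrahedron a b c d = 0 ∨
      (hops a b = 3 ∧ hops a c = 3 ∧ hops b c = 3) ∧
        hops a d = 3 ∧ hops b d = 3 ∧ hops c d = 3 := by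
  decide +kernel

theorem tetraVertex_lt : ∀ i, tetraVertex i 0 < tetraVertex i 1 ∧
    tetraVertex i 1 < tetraVertex i 2 ∧ tetraVertex i 2 < tetraVertex i 3 := by
  decide +kernel

/-- The centre is an interior point of these tetrahedra, so the ray leaves each of them exactly
once; the sign depends on the order of the vertices. -/
theorem rayTetrahedron_tetraVertex : ∀ i,
    rayTetrahedron (tetraVertex i 0) (tetraVertex i 1) (tetraVertex i 2) (tetraVertex i 3) = 1 ∨
    rayTetrahedron (tetraVertex i 0) (tetraVertex i 1) (tetraVertex i 2) (tetraVertex i 3) =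
      -1 := by
  decide +kernel

theorem isUnit_rayCochain_boundary {τ : Finset (Fin 20)}
    (hτ : τ ∈ distanceThreeTetrahedra graph) :
    IsUnit (rayCochain (boundary (Finsupp.single τ 1))) := by
  rw [distanceThreeTetrahedra_eq] at hτ
  obtain ⟨i, rfl⟩ := hτ
  have hi : Finset.univ.image (tetraVertex i) =
      {tetraVertex i 0, tetraVertex i 1, tetraVertex i 2, tetraVertex i 3} := by
    ext x
    simp [Fin.exists_fin_succ, eq_comm]
  obtain ⟨h01, h12, h23⟩ := tetraVertex_lt i
  simp only [hi]
  rw [boundary_single, one_smul, rayCochain_simplexBoundary h01 h12 h23, Int.isUnit_iff]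
  exact rayTetrahedron_tetraVertex i

theorem rayCochain_eq_zero_of_mem_boundaries : ∀ b ∈ boundaries reducedVR 2, rayCochain b = 0 := by
  refine linearCombination_eq_zero_of_mem_boundaries fun s hs hc => ?_
  obtain ⟨a, b, c, d, hab, hbc, hcd, rfl⟩ := Finset.exists_lt_of_card_eq_four hc
  have h3 := (mem_vietorisRips_iff.1 hs.1).2
  refine (rayCochain_simplexBoundary hab hbc hcd).trans ?_
  refine (rayTetrahedron_eq_zero a b hab (h3 a (by simp) b (by simp)) c hbc
    ⟨h3 a (by simp) c (by simp), h3 b (by simp) c (by simp)⟩ d hcd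
    ⟨h3 a (by simp) d (by simp), h3 b (by simp) d (by simp),
      h3 c (by simp) d (by simp)⟩).resolve_right ?_
  -- In the exceptional case the tetrahedron is one of those removed from the complex.
  rintro ⟨⟨h1, h2, h3⟩, h4, h5, h6⟩
  refine hs.2 _ (mem_distanceThreeTetrahedra_iff.2 ⟨hc, ?_⟩) subset_rfl
  intro x hx y hy hxy
  simp only [Finset.mem_insert, Finset.mem_singleton] at hx hy
  rcases hx with rfl | rfl | rfl | rfl <;> rcases hy with rfl | rfl | rfl | rfl <;>
    first | exact absurd rfl hxy | assumption | (rw [hops_comm]; assumption)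

theorem boundary_mem_cycles_reducedVR {τ : Finset (Fin 20)}
    (hτ : τ ∈ distanceThreeTetrahedra graph) :
    boundary (Finsupp.single τ 1) ∈ cycles reducedVR 2 := by
  refine ⟨?_, boundary_boundary _⟩
  have hc := (mem_distanceThreeTetrahedra_iff.1 hτ).1
  have h3 := (mem_distanceThreeTetrahedra_iff.1 hτ).2
  rw [boundary_single, one_smul, simplexBoundary, if_neg (by omega)]
  refine Submodule.sum_mem _ fun v hv => Finsupp.single_mem_supported ℤ _ ?_
  have he : (τ.erase v).card = 3 := by rw [Finset.card_erase_of_mem hv, hc]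
  refine ⟨⟨mem_vietorisRips_iff.2 ⟨Finset.card_pos.1 (by omega), fun x hx y hy => ?_⟩,
    fun t ht hts => ?_⟩, he⟩
  · by_cases hxy : x = y
    · rw [hops_eq_zero.2 hxy]; omega
    · exact (h3 x (Finset.mem_of_mem_erase hx) y (Finset.mem_of_mem_erase hy) hxy).le
  -- A triangle cannot contain one of the removed tetrahedra.
  · have := Finset.card_le_card hts
    rw [ht.1, he] at this
    omega

/-! ### Reduction to the complex of diameter two -/

/-- The triangle `{x, y, z}` has an edge of length `3` from `x` to `y`, and `z` is the neighbour of
`min x y` on the geodesic between them. -/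
def isPeak (x y z : Fin 20) : Bool :=
  hops x y == 3 && (if x < y then hops x z == 1 && hops z y == 2
    else hops y z == 1 && hops z x == 2)

/-- The triangle `{x, y, z}` has diameter at most `2` or is of the form `isPeak`. -/
def isBasic (x y z : Fin 20) : Bool :=
  (Nat.ble (hops x y) 2 && Nat.ble (hops x z) 2 && Nat.ble (hops y z) 2) ||
    isPeak x y z || isPeak x z y || isPeak y z x

/-- The vertices `x, y, z, w` have mutual distances at most `3`, not all of them equal to `3`. -/
def isReducedTetrahedron (x y z w : Fin 20) : Bool :=
  Nat.ble (hops x w) 3 && Nat.ble (hops y w) 3 && Nat.ble (hops z w) 3 &&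
    (x != w && y != w && z != w) &&
    !(hops x y == 3 && hops x z == 3 && hops y z == 3 &&
      hops x w == 3 && hops y w == 3 && hops z w == 3)

/-- The triangles that satisfy `P` or are a face of a tetrahedron whose other faces satisfy `P`. -/
def fill (P : Fin 20 → Fin 20 → Fin 20 → Bool) (x y z : Fin 20) : Bool :=
  P x y z || (List.finRange 20).any fun w =>
    isReducedTetrahedron x y z w && P x y w && P x z w && P y z w

/-- The combinatorial core of the reduction to diameter 2: starting from the triangles of diameter
at most 2 and one peak for each edge of length 3, two rounds of filling across admissible tetrahedra
reach every triangle. -/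
theorem fill_fill_isBasic : ∀ x y, x < y → hops x y ≤ 3 →
    ∀ z, y < z → hops x z ≤ 3 ∧ hops y z ≤ 3 → fill (fill isBasic) x y z = true := by
  decide +kernel

/-- Geodesics of length 3 are unique in the dodecahedron, and the order of the ends selects one of
the two inner vertices. -/
theorem isPeak_unique : ∀ x y, hops x y = 3 → ∀ z, isPeak x y z = true →
    ∀ w, isPeak x y w = true → z = w := by
  decide +kernel

theorem isPeak_hops : ∀ x y z, isPeak x y z = true →
    hops x y = 3 ∧ hops x z ≤ 2 ∧ hops y z ≤ 2 := by
  decide +kernel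

theorem isPeak_comm : ∀ x y z, isPeak x y z = isPeak y x z := by
  decide +kernel

end Dodecahedron

namespace Dodecahedron

open SimplicialHomology

/-- Triangles with vertices at mutual distances at most `3` that satisfy `P` lie in `M`. -/
def TrianglesMem (M : Submodule ℤ (Finset (Fin 20) →₀ ℤ))
    (P : Fin 20 → Fin 20 → Fin 20 → Bool) : Prop :=
  ∀ x y z, x ≠ y → x ≠ z → y ≠ z → hops x y ≤ 3 → hops x z ≤ 3 → hops y z ≤ 3 →
    P x y z = true → Finsupp.single {x, y, z} 1 ∈ M

/-- If three faces of a tetrahedron of `reducedVR` lie in `M`, then so does the fourth, because the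
boundary of the tetrahedron lies in `M`. -/
theorem TrianglesMem.fill {M : Submodule ℤ (Finset (Fin 20) →₀ ℤ)}
    (hM : boundaries reducedVR 2 ≤ M) {P : Fin 20 → Fin 20 → Fin 20 → Bool}
    (hP : TrianglesMem M P) : TrianglesMem M (fill P) := by
  intro x y z hxy hxz hyz dxy dxz dyz h
  simp only [Dodecahedron.fill, Bool.or_eq_true, List.any_eq_true, Bool.and_eq_true] at h
  rcases h with h | ⟨w, -, ⟨⟨hw, h1⟩, h2⟩, h3⟩
  · exact hP x y z hxy hxz hyz dxy dxz dyz h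
  simp only [isReducedTetrahedron, Bool.and_eq_true, Nat.ble_eq, bne_iff_ne, ne_eq,
    Bool.not_eq_true', Bool.and_eq_false_iff, beq_eq_false_iff_ne] at hw
  obtain ⟨⟨⟨⟨dxw, dyw⟩, dzw⟩, ⟨hxw, hyw⟩, hzw⟩, hne⟩ := hw
  have hc : ({x, y, z, w} : Finset (Fin 20)).card = 4 :=
    Finset.card_eq_four.2 ⟨x, y, z, w, hxy, hxz, hxw, hyz, hyw, hzw, rfl⟩
  have ex : ({x, y, z, w} : Finset (Fin 20)).erase x = {y, z, w} := by grind
  have ey : ({x, y, z, w} : Finset (Fin 20)).erase y = {x, z, w} := by grind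
  have ez : ({x, y, z, w} : Finset (Fin 20)).erase z = {x, y, w} := by grind
  have ew : ({x, y, z, w} : Finset (Fin 20)).erase w = {x, y, z} := by grind
  -- The test `isReducedTetrahedron` bounds only the distances to `w`; the other three bounds are
  -- hypotheses on the triangle.
  have hs : ({x, y, z, w} : Finset (Fin 20)) ∈ reducedVR.faces := by
    rw [faces_reducedVR]
    refine ⟨mem_vietorisRips_iff.2 ⟨⟨x, by simp⟩, fun a ha b hb => ?_⟩, fun hs => ?_⟩
    · by_cases hab : a = b
      · rw [hops_eq_zero.2 hab]; omega
      simp only [Finset.mem_insert, Finset.mem_singleton] at ha hb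
      rcases ha with rfl | rfl | rfl | rfl <;> rcases hb with rfl | rfl | rfl | rfl <;>
        first | exact absurd rfl hab | assumption | (rw [hops_comm]; assumption)
    · have h3 := (mem_distanceThreeTetrahedra_iff.1 hs).2
      have hxy3 := h3 x (by simp) y (by simp) hxy
      have hxz3 := h3 x (by simp) z (by simp) hxz
      have hxw3 := h3 x (by simp) w (by simp) hxw
      have hyz3 := h3 y (by simp) z (by simp) hyz
      have hyw3 := h3 y (by simp) w (by simp) hyw
      have hzw3 := h3 z (by simp) w (by simp) hzw
      tauto
  rw [← ew]
  refine single_erase_mem hM hs hc (by simp) fun u hu huw => ?_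
  simp only [Finset.mem_insert, Finset.mem_singleton] at hu
  rcases hu with rfl | rfl | rfl | rfl
  · rw [ex]; exact hP y z w hyz hyw hzw dyz dyw dzw h3
  · rw [ey]; exact hP x z w hxz hxw hzw dxz dxw dzw h2
  · rw [ez]; exact hP x y w hxy hxw hyw dxy dxw dyw h1
  · exact absurd rfl huw

/-- One triangle on each edge of length `3`. -/
def peaks : Set (Finset (Fin 20)) := {s | ∃ x y z, isPeak x y z = true ∧ s = {x, y, z}}

/-- A peak has only one edge of length 3, and this edge determines the peak. -/
theorem eq_of_mem_peaks {x y z : Fin 20} (h : isPeak x y z = true) {t : Finset (Fin 20)}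
    (ht : t ∈ peaks) (hx : x ∈ t) (hy : y ∈ t) : t = {x, y, z} := by
  obtain ⟨x', y', z', h', rfl⟩ := ht
  have h3 := (isPeak_hops x y z h).1
  obtain ⟨-, hxz, hyz⟩ := isPeak_hops x' y' z' h'
  have hne : ∀ {a b}, hops a b ≤ 2 → hops a b ≠ 3 := by intro a b; omega
  simp only [Finset.mem_insert, Finset.mem_singleton] at hx hy
  rcases hx with rfl | rfl | rfl <;> rcases hy with rfl | rfl | rfl
  · rw [hops_eq_zero.2 rfl] at h3; omega
  · rw [isPeak_unique _ _ h3 _ h _ h']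
  · exact absurd h3 (hne hxz)
  · rw [isPeak_comm] at h'
    rw [isPeak_unique _ _ h3 _ h _ h', Finset.insert_comm]
  · rw [hops_eq_zero.2 rfl] at h3; omega
  · exact absurd h3 (hne hyz)
  · exact absurd h3 (hne (hops_comm x y ▸ hxz))
  · exact absurd h3 (hne (hops_comm x y ▸ hyz))
  · rw [hops_eq_zero.2 rfl] at h3; omega

/-- Once a cycle is written with triangles of diameter at most 2 and peaks, the long edge of a peak
lies in no other triangle, so the peaks drop out. -/
theorem exists_cycle_vietorisRips_two {z : Finset (Fin 20) →₀ ℤ} (hz : z ∈ cycles reducedVR 2) :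
    ∃ y ∈ cycles (vietorisRips graph 2) 2, z - y ∈ boundaries reducedVR 2 := by
  refine exists_cycle_sub_mem_boundaries two_pos peaks ?_ ?_ hz
  · intro s hs hc
    obtain ⟨x, y, z, hxy, hyz, rfl⟩ := Finset.exists_lt_of_card_eq_three hc
    have hxz := hxy.trans hyz
    have h3 := (mem_vietorisRips_iff.1 hs.1).2
    have dxy := h3 x (by simp) y (by simp)
    have dxz := h3 x (by simp) z (by simp)
    have dyz := h3 y (by simp) z (by simp)
    refine (TrianglesMem.fill le_sup_left (TrianglesMem.fill le_sup_left ?_)) x y z hxy.ne hxz.ne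
      hyz.ne dxy dxz dyz (fill_fill_isBasic x y hxy dxy z hyz ⟨dxz, dyz⟩)
    intro x y z hxy hxz hyz _ _ _ h
    refine Submodule.mem_sup_right (Finsupp.single_mem_supported ℤ _
      ⟨Finset.card_eq_three.2 ⟨x, y, z, hxy, hxz, hyz, rfl⟩, ?_⟩)
    simp only [isBasic, Bool.or_eq_true, Bool.and_eq_true, Nat.ble_eq] at h
    rcases h with ((⟨⟨h1, h2⟩, h3⟩ | h) | h) | h
    · refine .inl (mem_vietorisRips_iff.2 ⟨⟨x, by simp⟩, fun a ha b hb => ?_⟩)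
      by_cases hab : a = b
      · rw [hops_eq_zero.2 hab]; omega
      simp only [Finset.mem_insert, Finset.mem_singleton] at ha hb
      rcases ha with rfl | rfl | rfl <;> rcases hb with rfl | rfl | rfl <;>
        first | exact absurd rfl hab | assumption | (rw [hops_comm]; assumption)
    · exact .inr ⟨x, y, z, h, rfl⟩
    · exact .inr ⟨x, z, y, h, by rw [Finset.pair_comm]⟩
    · exact .inr ⟨y, z, x, h, by rw [Finset.insert_comm, Finset.pair_comm]⟩
  · rintro s ⟨x, y, z, h, rfl⟩ -
    obtain ⟨h3, hxz, hyz⟩ := isPeak_hops x y z h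
    -- Deleting `z` leaves the edge of length 3.
    refine ⟨z, by simp, fun t _ ht hst => ?_⟩
    have hx : x ∈ t := hst (by
      refine Finset.mem_erase.2 ⟨?_, by simp⟩
      rintro rfl
      rw [hops_comm] at hyz
      omega)
    have hy : y ∈ t := hst (by
      refine Finset.mem_erase.2 ⟨?_, by simp⟩
      rintro rfl
      omega)
    rcases ht with ht | ht
    · have := (mem_vietorisRips_iff.1 ht).2 x hx y hy
      omega
    · exact eq_of_mem_peaks h ht hx hy

/-! ### Reduction to a triangulation of the boundary sphere -/

/-- Besides the triangles inside facets, the only triangles of diameter at most 2 are those formed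
by the three neighbours of a vertex. -/
theorem exists_facet_or_neighbour : ∀ x y, x < y → hops x y ≤ 2 →
    ∀ z, y < z → hops x z ≤ 2 ∧ hops y z ≤ 2 →
    (∃ i, (∃ m, corner i m = x) ∧ (∃ m, corner i m = y) ∧ ∃ m, corner i m = z) ∨
      ∃ v, hops v x = 1 ∧ hops v y = 1 ∧ hops v z = 1 := by
  decide +kernel

theorem exists_facet_of_neighbours : ∀ v x, hops v x = 1 → ∀ y, hops v y = 1 →
    ∃ i, (∃ m, corner i m = v) ∧ (∃ m, corner i m = x) ∧ ∃ m, corner i m = y := by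
  decide +kernel

/-- A diagonal lies in only one facet, in contrast to an edge of the dodecahedron. -/
theorem facet_unique_of_hops_eq_two : ∀ i k m, hops (corner i k) (corner i m) = 2 →
    ∀ l p, corner l p = corner i k → ∀ q, corner l q = corner i m → l = i := by
  decide +kernel

theorem exists_corner_of_mem_facet {i : Fin 12} {x : Fin 20} (hx : x ∈ facet i) :
    ∃ m, corner i m = x := by
  obtain ⟨m, -, h⟩ := Finset.mem_image.1 hx
  exact ⟨m, h⟩

theorem facet_eq_of_hops_eq_two {F G : Finset (Fin 20)} (hF : IsFacet F) (hG : IsFacet G)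
    {x y : Fin 20} (hxy : hops x y = 2) (hxF : x ∈ F) (hyF : y ∈ F) (hxG : x ∈ G) (hyG : y ∈ G) :
    G = F := by
  obtain ⟨i, rfl⟩ := isFacet_iff.1 hF
  obtain ⟨l, rfl⟩ := isFacet_iff.1 hG
  obtain ⟨k, rfl⟩ := exists_corner_of_mem_facet hxF
  obtain ⟨m, rfl⟩ := exists_corner_of_mem_facet hyF
  obtain ⟨p, hp⟩ := exists_corner_of_mem_facet hxG
  obtain ⟨q, hq⟩ := exists_corner_of_mem_facet hyG
  rw [facet_unique_of_hops_eq_two i k m hxy l p hp q hq]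

theorem subset_facet_of_corner {i : Fin 12} {x y z : Fin 20}
    (h : (∃ m, corner i m = x) ∧ (∃ m, corner i m = y) ∧ ∃ m, corner i m = z) :
    ({x, y, z} : Finset (Fin 20)) ⊆ facet i := by
  obtain ⟨⟨k, rfl⟩, ⟨m, rfl⟩, n, rfl⟩ := h
  intro w hw
  simp only [Finset.mem_insert, Finset.mem_singleton] at hw
  rcases hw with rfl | rfl | rfl <;> exact corner_mem_facet _ _

/-- The sets of vertices of a facet that contain its apex. -/
def apexSets (apex : Finset (Fin 20) → Fin 20) : Set (Finset (Fin 20)) :=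
  {s | ∃ F, IsFacet F ∧ s ⊆ F ∧ apex F ∈ s}

variable {apex : Finset (Fin 20) → Fin 20}

theorem mem_boundarySphere_of_card_eq_three {s : Finset (Fin 20)}
    (hs : s ∈ (boundarySphere apex).faces) (hc : s.card = 3) :
    ∃ F, IsFacet F ∧ ∃ x ∈ F, ∃ y ∈ F, hops x y = 1 ∧ apex F ≠ x ∧ apex F ≠ y ∧
      s = {apex F, x, y} := by
  obtain ⟨-, F, hF, x, hx, y, hy, hxy, hsub⟩ := hs
  obtain rfl := Finset.eq_of_subset_of_card_le hsub (hc ▸ Finset.card_le_three)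
  refine ⟨F, hF, x, hx, y, hy, (adj_iff_hops x y).1 hxy, ?_, ?_, rfl⟩
  · rintro rfl
    rw [Finset.insert_eq_of_mem (by simp)] at hc
    have := Finset.card_le_two (a := apex F) (b := y)
    omega
  · rintro rfl
    rw [Finset.insert_eq_of_mem (by simp)] at hc
    have := Finset.card_le_two (a := x) (b := apex F)
    omega

theorem mem_apexSets_of_mem_boundarySphere (hapex : ∀ F, IsFacet F → apex F ∈ F)
    {s : Finset (Fin 20)} (hs : s ∈ (boundarySphere apex).faces) (hc : s.card = 3) :
    s ∈ apexSets apex := by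
  obtain ⟨F, hF, x, hx, y, hy, -, -, -, rfl⟩ := mem_boundarySphere_of_card_eq_three hs hc
  refine ⟨F, hF, fun w hw => ?_, by simp⟩
  simp only [Finset.mem_insert, Finset.mem_singleton] at hw
  rcases hw with rfl | rfl | rfl
  exacts [hapex F hF, hx, hy]

theorem mem_vietorisRips_two_of_subset_facet {F s : Finset (Fin 20)} (hF : IsFacet F)
    (hs : s.Nonempty) (hsF : s ⊆ F) : s ∈ (vietorisRips graph 2).faces :=
  ⟨hs, fun _ hx _ hy => edist_le_two_of_isFacet hF (hsF hx) (hsF hy)⟩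

/-- A triangle avoiding the apex is a face of its cone from the apex, and the other faces of the
cone contain the apex. -/
theorem single_mem_of_subset_facet (hapex : ∀ F, IsFacet F → apex F ∈ F)
    {M : Submodule ℤ (Finset (Fin 20) →₀ ℤ)} (hM : boundaries (vietorisRips graph 2) 2 ≤ M)
    (hapexM : ∀ s ∈ apexSets apex, s.card = 3 → Finsupp.single s 1 ∈ M)
    {F s : Finset (Fin 20)} (hF : IsFacet F) (hsF : s ⊆ F) (hc : s.card = 3) :
    Finsupp.single s 1 ∈ M := by
  by_cases ha : apex F ∈ s
  · exact hapexM s ⟨F, hF, hsF, ha⟩ hc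
  rw [← Finset.erase_insert ha]
  have hsub : insert (apex F) s ⊆ F := Finset.insert_subset (hapex F hF) hsF
  have hc' : (insert (apex F) s).card = 4 := by rw [Finset.card_insert_of_notMem ha, hc]
  refine single_erase_mem hM (mem_vietorisRips_two_of_subset_facet hF (Finset.insert_nonempty _ _) hsub)
    hc' (Finset.mem_insert_self _ _) fun u hu hua => ?_
  refine hapexM _ ⟨F, hF, (Finset.erase_subset _ _).trans hsub, ?_⟩ ?_
  · exact Finset.mem_erase.2 ⟨hua.symm, Finset.mem_insert_self _ _⟩
  · rw [Finset.card_erase_of_mem hu, hc']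

/-- A triangle of neighbours of `v` is exchanged for three triangles in the facets at `v`, and
triangles in facets for triangles through the apex. Such a triangle that is not in the sphere has a
diagonal opposite to its apex, and this diagonal lies in no other triangle in use. -/
theorem exists_cycle_boundarySphere (hapex : ∀ F, IsFacet F → apex F ∈ F)
    {z : Finset (Fin 20) →₀ ℤ} (hz : z ∈ cycles (vietorisRips graph 2) 2) :
    ∃ y ∈ cycles (boundarySphere apex) 2, z - y ∈ boundaries (vietorisRips graph 2) 2 := by
  refine exists_cycle_sub_mem_boundaries two_pos {s | s ∈ apexSets apex ∧ s.card = 3} ?_ ?_ hz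
  · intro s hs hc
    have key := fun F (s : Finset (Fin 20)) => single_mem_of_subset_facet (F := F) (s := s) hapex
      (M := boundaries (vietorisRips graph 2) 2 ⊔ Finsupp.supported ℤ ℤ {t | t.card = 2 + 1 ∧
        (t ∈ (boundarySphere apex).faces ∨ t ∈ {s | s ∈ apexSets apex ∧ s.card = 3})})
      le_sup_left fun t ht htc => Submodule.mem_sup_right (Finsupp.single_mem_supported ℤ _
        ⟨htc, .inr ⟨ht, htc⟩⟩)
    obtain ⟨x, y, z, hxy, hyz, rfl⟩ := Finset.exists_lt_of_card_eq_three hc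
    have hxz := hxy.trans hyz
    have h2 := (mem_vietorisRips_iff.1 hs).2
    have dxy := h2 x (by simp) y (by simp)
    have dxz := h2 x (by simp) z (by simp)
    have dyz := h2 y (by simp) z (by simp)
    rcases exists_facet_or_neighbour x y hxy dxy z hyz ⟨dxz, dyz⟩ with ⟨i, hi⟩ | ⟨v, vx, vy, vz⟩
    · exact key (facet i) _ (isFacet_facet i) (subset_facet_of_corner hi) hc
    have hne : ∀ {a}, hops v a = 1 → v ≠ a := by
      rintro a h rfl
      rw [hops_eq_zero.2 rfl] at h; omega
    have hface : ∀ a b, a ≠ b → hops v a = 1 → hops v b = 1 → Finsupp.single {v, a, b} 1 ∈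
        boundaries (vietorisRips graph 2) 2 ⊔ Finsupp.supported ℤ ℤ {t | t.card = 2 + 1 ∧
          (t ∈ (boundarySphere apex).faces ∨ t ∈ {s | s ∈ apexSets apex ∧ s.card = 3})} := by
      intro a b hab ha hb
      obtain ⟨i, hi⟩ := exists_facet_of_neighbours v a ha b hb
      exact key (facet i) _ (isFacet_facet i) (subset_facet_of_corner hi)
        (Finset.card_eq_three.2 ⟨v, a, b, hne ha, hne hb, hab, rfl⟩)
    have hc4 : ({v, x, y, z} : Finset (Fin 20)).card = 4 :=
      Finset.card_eq_four.2 ⟨v, x, y, z, hne vx, hne vy, hne vz, hxy.ne, hxz.ne, hyz.ne, rfl⟩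
    have hvx := hne vx
    have hvy := hne vy
    have hvz := hne vz
    have ev : ({v, x, y, z} : Finset (Fin 20)).erase v = {x, y, z} := by grind
    have ex : ({v, x, y, z} : Finset (Fin 20)).erase x = {v, y, z} := by grind
    have ey : ({v, x, y, z} : Finset (Fin 20)).erase y = {v, x, z} := by grind
    have ez : ({v, x, y, z} : Finset (Fin 20)).erase z = {v, x, y} := by grind
    have hs4 : ({v, x, y, z} : Finset (Fin 20)) ∈ (vietorisRips graph 2).faces := by
      refine mem_vietorisRips_iff.2 ⟨⟨v, by simp⟩, fun a ha b hb => ?_⟩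
      rw [Finset.mem_insert] at ha hb
      have h1 : ∀ a ∈ ({x, y, z} : Finset (Fin 20)), hops v a ≤ 2 := by
        intro a ha
        simp only [Finset.mem_insert, Finset.mem_singleton] at ha
        rcases ha with rfl | rfl | rfl <;> omega
      rcases ha with rfl | ha <;> rcases hb with rfl | hb
      · rw [hops_eq_zero.2 rfl]; omega
      · exact h1 b hb
      · rw [hops_comm]; exact h1 a ha
      · exact h2 a ha b hb
    rw [← ev]
    refine single_erase_mem le_sup_left hs4 hc4 (by simp) fun u hu huv => ?_
    simp only [Finset.mem_insert, Finset.mem_singleton] at hu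
    rcases hu with rfl | rfl | rfl | rfl
    · exact absurd rfl huv
    · rw [ex]; exact hface y z hyz.ne vy vz
    · rw [ey]; exact hface x z hxz.ne vx vz
    · rw [ez]; exact hface x y hxy.ne vx vy
  · rintro s ⟨⟨F, hF, hsF, ha⟩, hc⟩ hs
    -- The free face is the side opposite to the apex. It has length 2, since otherwise `s` would
    -- belong to the triangulated sphere.
    refine ⟨apex F, ha, fun t htc ht hst => ?_⟩
    have ht' : t ∈ apexSets apex :=
      ht.elim (fun h => mem_apexSets_of_mem_boundarySphere hapex h htc) fun h => h.1
    obtain ⟨G, hG, htG, hat⟩ := ht'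
    have he : (s.erase (apex F)).card = 2 := by rw [Finset.card_erase_of_mem ha, hc]
    obtain ⟨p, q, hpq, hs2⟩ := Finset.card_eq_two.1 he
    have hs3 : s = {apex F, p, q} := by rw [← Finset.insert_erase ha, hs2]
    have hpF : p ∈ F := hsF (by simp [hs3])
    have hqF : q ∈ F := hsF (by simp [hs3])
    have hpt : p ∈ t := hst (by simp [hs2])
    have hqt : q ∈ t := hst (by simp [hs2])
    have h2 : hops p q = 2 := by
      have hle : hops p q ≤ 2 := by
        have := edist_le_two_of_isFacet hF hpF hqF
        rw [edist_eq_hops] at this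
        exact_mod_cast this
      have h0 : hops p q ≠ 0 := fun h => hpq (hops_eq_zero.1 h)
      have h1 : hops p q ≠ 1 := fun h => hs
        ⟨⟨_, ha⟩, F, hF, p, hpF, q, hqF, (adj_iff_hops p q).2 h, hs3.subset⟩
      omega
    obtain rfl := facet_eq_of_hops_eq_two hF hG h2 hpF hqF (htG hpt) (htG hqt)
    refine (Finset.eq_of_subset_of_card_le ?_ (htc.trans hc.symm).le).symm
    rw [← Finset.insert_erase ha]
    exact Finset.insert_subset hat hst

end Dodecahedron

namespace Dodecahedron

open SimplicialHomology

/-! ### Cycles of a triangulation of the boundary sphere -/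

/-- The corners of the triangle with apex `k` and opposite edge from `m` to `m + 1`. -/
def fanCorners (k m : Fin 5) : Finset (Fin 5) := {k, m, m + 1}

/-- The triangle in the facet `i` with apex `k` and opposite edge from `m` to `m + 1`. -/
def fanTriangle (i : Fin 12) (k m : Fin 5) : Finset (Fin 20) := (fanCorners k m).image (corner i)

theorem corner_mem_fanTriangle {i : Fin 12} {k m n : Fin 5} :
    corner i n ∈ fanTriangle i k m ↔ n ∈ fanCorners k m := by
  rw [fanTriangle, Finset.mem_image]
  exact ⟨fun ⟨p, hp, h⟩ => corner_injective i p n h ▸ hp, fun h => ⟨n, h, rfl⟩⟩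

theorem card_fanCorners : ∀ k m : Fin 5, m ≠ k → m + 1 ≠ k → (fanCorners k m).card = 3 := by
  decide +kernel

theorem card_fanTriangle (i : Fin 12) {k m : Fin 5} (h : m ≠ k) (h' : m + 1 ≠ k) :
    (fanTriangle i k m).card = 3 := by
  rw [fanTriangle, Finset.card_image_of_injective _ fun m n => corner_injective i m n,
    card_fanCorners k m h h']

theorem fanTriangle_subset_facet (i : Fin 12) (k m : Fin 5) : fanTriangle i k m ⊆ facet i :=
  Finset.image_subset_image (Finset.subset_univ _)

theorem fanTriangle_eq (i : Fin 12) (k m : Fin 5) :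
    fanTriangle i k m = {corner i k, corner i m, corner i (m + 1)} := by
  simp [fanTriangle, fanCorners, Finset.image_insert]

variable {apex : Finset (Fin 20) → Fin 20} {κ : Fin 12 → Fin 5}

theorem exists_eq_fanTriangle (hκ : ∀ i, apex (facet i) = corner i (κ i)) {s : Finset (Fin 20)}
    (hs : s ∈ (boundarySphere apex).faces) (hc : s.card = 3) :
    ∃ i m, m ≠ κ i ∧ m + 1 ≠ κ i ∧ s = fanTriangle i (κ i) m := by
  obtain ⟨F, hF, x, hx, y, hy, hxy, hax, hay, rfl⟩ := mem_boundarySphere_of_card_eq_three hs hc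
  obtain ⟨i, rfl⟩ := isFacet_iff.1 hF
  obtain ⟨m, rfl⟩ := exists_corner_of_mem_facet hx
  obtain ⟨n, rfl⟩ := exists_corner_of_mem_facet hy
  rw [hκ] at hax hay ⊢
  have hm : m ≠ κ i := fun h => hax (h ▸ rfl)
  have hn : n ≠ κ i := fun h => hay (h ▸ rfl)
  rcases eq_add_one_of_hops_corner i m n hxy with rfl | rfl
  · exact ⟨i, m, hm, hn, (fanTriangle_eq _ _ _).symm⟩
  · exact ⟨i, n, hn, hm, by rw [fanTriangle_eq, Finset.pair_comm]⟩

theorem fanTriangle_mem_boundarySphere (hκ : ∀ i, apex (facet i) = corner i (κ i)) (i : Fin 12)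
    (m : Fin 5) : fanTriangle i (κ i) m ∈ (boundarySphere apex).faces :=
  ⟨⟨corner i m, corner_mem_fanTriangle.2 (by simp [fanCorners])⟩, facet i, isFacet_facet i, _,
    corner_mem_facet i m, _, corner_mem_facet i (m + 1),
    (adj_iff_hops _ _).2 (hops_corner_succ i m), by rw [hκ, fanTriangle_eq]⟩

/-- If an edge `{x, y}` of the triangle `s` lies in no other triangle of the cycle `z`, then `s`
does not occur in `z`. -/
theorem apply_eq_zero_of_edge {z : Finset (Fin 20) →₀ ℤ} (hz : boundary z = 0)
    {s : Finset (Fin 20)} (hs : s.card = 3) {x y : Fin 20} (hx : x ∈ s) (hy : y ∈ s)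
    (h : ∀ t, z t ≠ 0 → x ∈ t → y ∈ t → t = s) : z s = 0 := by
  obtain ⟨v, hv, hxv, hyv⟩ := Finset.exists_mem_erase_of_ne (by omega) hx hy
  exact apply_eq_zero_of_boundary_eq_zero hz (by omega) hv fun t ht _ hst =>
    h t ht (hst hxv) (hst hyv)

/-- Under these conditions `m + 1` is neither `k` nor next to it, so this side, common to the fan
triangles `m` and `m + 1`, is a diagonal. -/
theorem hops_diagonal : ∀ i k m, m ≠ k → m + 1 ≠ k → m + 1 + 1 ≠ k →
    hops (corner i k) (corner i (m + 1)) = 2 := by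
  decide +kernel

theorem eq_or_eq_of_mem_fanCorners : ∀ k m n : Fin 5, m + 1 ≠ k → m + 1 ∈ fanCorners k n →
    n = m ∨ n = m + 1 := by
  decide +kernel

theorem exists_fanCorners : ∀ k m : Fin 5, ∃ n, n ≠ k ∧ n + 1 ≠ k ∧ m ∈ fanCorners k n ∧
    m + 1 ∈ fanCorners k n := by
  decide +kernel

theorem fanCorners_unique : ∀ k m n : Fin 5, n ≠ k ∧ n + 1 ≠ k →
    m ∈ fanCorners k n ∧ m + 1 ∈ fanCorners k n → ∀ p, p ≠ k ∧ p + 1 ≠ k →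
    m ∈ fanCorners k p ∧ m + 1 ∈ fanCorners k p → p = n := by
  decide +kernel

/-- The facets `i` and `l` have a common edge, with corners `m`, `m + 1` of the first and `n + 1`,
`n` of the second. -/
def AdjacentAt (i l : Fin 12) (m n : Fin 5) : Prop :=
  corner i m = corner l (n + 1) ∧ corner i (m + 1) = corner l n

instance (i l : Fin 12) (m n : Fin 5) : Decidable (AdjacentAt i l m n) :=
  inferInstanceAs (Decidable (_ ∧ _))

theorem AdjacentAt.symm {i l : Fin 12} {m n : Fin 5} (h : AdjacentAt i l m n) :
    AdjacentAt l i n m :=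
  ⟨h.2.symm, h.1.symm⟩

theorem exists_adjacentAt : ∀ i m, ∃ l n, AdjacentAt i l m n := by decide +kernel

theorem eq_or_eq_of_adjacentAt : ∀ i l m n, AdjacentAt i l m n →
    ∀ j p, corner j p = corner i m → ∀ q, corner j q = corner i (m + 1) → j = i ∨ j = l := by
  decide +kernel

/-- The adjacency graph of the facets is that of the icosahedron, of diameter 3. -/
theorem exists_chain_of_facets : ∀ l, ∃ a, (a = 0 ∨ ∃ m n, AdjacentAt 0 a m n) ∧
    ∃ b, (b = a ∨ ∃ m n, AdjacentAt a b m n) ∧ (l = b ∨ ∃ m n, AdjacentAt b l m n) := by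
  decide +kernel

theorem exists_eq_fanTriangle_of_apply_ne_zero
    (hκ : ∀ i, apex (facet i) = corner i (κ i))
    {z : Finset (Fin 20) →₀ ℤ} (hz : z ∈ cycles (boundarySphere apex) 2)
    {t : Finset (Fin 20)} (ht : z t ≠ 0) :
    ∃ i m, m ≠ κ i ∧ m + 1 ≠ κ i ∧ t = fanTriangle i (κ i) m := by
  obtain ⟨hs, hc⟩ := (Finsupp.mem_supported ℤ z).1 hz.1 (Finsupp.mem_support_iff.2 ht)
  exact exists_eq_fanTriangle hκ hs hc

/-- The diagonal between two consecutive triangles of a fan lies in no third triangle of the sphere,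
so a cycle that vanishes on one of the two vanishes on the other. -/
theorem apply_fanTriangle_succ_eq_zero_iff
    (hκ : ∀ i, apex (facet i) = corner i (κ i))
    {z : Finset (Fin 20) →₀ ℤ} (hz : z ∈ cycles (boundarySphere apex) 2)
    {i : Fin 12} {m : Fin 5} (h0 : m ≠ κ i)
    (h1 : m + 1 ≠ κ i) (h2 : m + 1 + 1 ≠ κ i) :
    z (fanTriangle i (κ i) (m + 1)) = 0 ↔ z (fanTriangle i (κ i) m) = 0 := by
  have key : ∀ t, z t ≠ 0 → corner i (κ i) ∈ t → corner i (m + 1) ∈ t →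
      t = fanTriangle i (κ i) m ∨ t = fanTriangle i (κ i) (m + 1) := by
    intro t ht hk hm
    obtain ⟨l, n, -, -, rfl⟩ := exists_eq_fanTriangle_of_apply_ne_zero hκ hz ht
    obtain ⟨p, hp⟩ := exists_corner_of_mem_facet (fanTriangle_subset_facet _ _ _ hk)
    obtain ⟨q, hq⟩ := exists_corner_of_mem_facet (fanTriangle_subset_facet _ _ _ hm)
    obtain rfl := facet_unique_of_hops_eq_two i _ _ (hops_diagonal i _ m h0 h1 h2) l p hp q hq
    rcases eq_or_eq_of_mem_fanCorners _ m n h1 (corner_mem_fanTriangle.1 hm) with rfl | rfl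
    · exact .inl rfl
    · exact .inr rfl
  constructor <;> intro h
  · refine apply_eq_zero_of_edge hz.2 (card_fanTriangle i h0 h1) (x := corner i (κ i))
      (y := corner i (m + 1)) (corner_mem_fanTriangle.2 (by simp [fanCorners]))
      (corner_mem_fanTriangle.2 (by simp [fanCorners])) fun t ht hx hy => ?_
    exact (key t ht hx hy).resolve_right fun h' => ht (h' ▸ h)
  · refine apply_eq_zero_of_edge hz.2 (card_fanTriangle i h1 h2) (x := corner i (κ i))
      (y := corner i (m + 1)) (corner_mem_fanTriangle.2 (by simp [fanCorners]))
      (corner_mem_fanTriangle.2 (by simp [fanCorners])) fun t ht hx hy => ?_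
    exact (key t ht hx hy).resolve_left fun h' => ht (h' ▸ h)

theorem apply_fanTriangle_eq_zero
    (hκ : ∀ i, apex (facet i) = corner i (κ i))
    {z : Finset (Fin 20) →₀ ℤ} (hz : z ∈ cycles (boundarySphere apex) 2)
    {i : Fin 12} {m : Fin 5} (hm : m ≠ κ i) (hm' : m + 1 ≠ κ i)
    (h : z (fanTriangle i (κ i) m) = 0) {n : Fin 5} (hn : n ≠ κ i) (hn' : n + 1 ≠ κ i) :
    z (fanTriangle i (κ i) n) = 0 := by
  -- The three triangles of the fan from `k` have the indices `k + 1`, `k + 2` and `k + 3`; two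
  -- diagonals link them in a row.
  have cases : ∀ k m : Fin 5, m ≠ k → m + 1 ≠ k →
      m = k + 1 ∨ m = k + 1 + 1 ∨ m = k + 1 + 1 + 1 := by decide
  have ne : ∀ k : Fin 5, k + 1 ≠ k ∧ k + 1 + 1 ≠ k ∧ k + 1 + 1 + 1 ≠ k ∧ k + 1 + 1 + 1 + 1 ≠ k := by
    decide
  obtain ⟨n1, n2, n3, n4⟩ := ne (κ i)
  have e1 := apply_fanTriangle_succ_eq_zero_iff hκ hz n1 n2 n3
  have e2 := apply_fanTriangle_succ_eq_zero_iff hκ hz n2 n3 n4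
  have h1 : z (fanTriangle i (κ i) (κ i + 1)) = 0 := by
    rcases cases _ m hm hm' with rfl | rfl | rfl
    · exact h
    · exact e1.1 h
    · exact e1.1 (e2.1 h)
  rcases cases _ n hn hn' with rfl | rfl | rfl
  · exact h1
  · exact e1.2 h1
  · exact e2.2 (e1.2 h1)

/-- The edge common to two facets lies in one fan triangle of each and in no further triangle, so
vanishing passes across it. -/
theorem apply_fanTriangle_eq_zero_of_adjacentAt
    (hκ : ∀ i, apex (facet i) = corner i (κ i))
    {z : Finset (Fin 20) →₀ ℤ} (hz : z ∈ cycles (boundarySphere apex) 2)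
    {i l : Fin 12} {m n : Fin 5}
    (hil : AdjacentAt i l m n)
    (h : ∀ p, p ≠ κ i → p + 1 ≠ κ i → z (fanTriangle i (κ i) p) = 0) {p : Fin 5} (hp : p ≠ κ l)
    (hp' : p + 1 ≠ κ l) : z (fanTriangle l (κ l) p) = 0 := by
  obtain ⟨q, hq, hq', hnq, hnq'⟩ := exists_fanCorners (κ l) n
  refine apply_fanTriangle_eq_zero hκ hz hq hq' ?_ hp hp'
  refine apply_eq_zero_of_edge hz.2 (card_fanTriangle l hq hq')
    (corner_mem_fanTriangle.2 hnq) (corner_mem_fanTriangle.2 hnq') fun t ht hx hy => ?_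
  obtain ⟨j, r, hr, hr', rfl⟩ := exists_eq_fanTriangle_of_apply_ne_zero hκ hz ht
  obtain ⟨u, hu⟩ := exists_corner_of_mem_facet (fanTriangle_subset_facet _ _ _ hx)
  obtain ⟨v, hv⟩ := exists_corner_of_mem_facet (fanTriangle_subset_facet _ _ _ hy)
  rcases eq_or_eq_of_adjacentAt l i n m hil.symm j u hu v hv with rfl | rfl
  · rw [fanCorners_unique _ n q ⟨hq, hq'⟩ ⟨hnq, hnq'⟩ r ⟨hr, hr'⟩
      ⟨corner_mem_fanTriangle.1 hx, corner_mem_fanTriangle.1 hy⟩]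
  · exact absurd (h r hr hr') ht

/-- The triangles of the sphere are connected through common edges, each contained in exactly two of
them, so a zero coefficient spreads from one triangle to all. -/
theorem eq_zero_of_apply_eq_zero
    (hκ : ∀ i, apex (facet i) = corner i (κ i))
    {z : Finset (Fin 20) →₀ ℤ} (hz : z ∈ cycles (boundarySphere apex) 2)
    {m : Fin 5} (hm : m ≠ κ 0) (hm' : m + 1 ≠ κ 0)
    (h : z (fanTriangle 0 (κ 0) m) = 0) : z = 0 := by
  have step : ∀ {i l}, (l = i ∨ ∃ m n, AdjacentAt i l m n) →
      (∀ p, p ≠ κ i → p + 1 ≠ κ i → z (fanTriangle i (κ i) p) = 0) →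
      ∀ p, p ≠ κ l → p + 1 ≠ κ l → z (fanTriangle l (κ l) p) = 0 := by
    rintro i l (rfl | ⟨m, n, hil⟩) h
    · exact h
    · exact fun p hp hp' => apply_fanTriangle_eq_zero_of_adjacentAt hκ hz hil h hp hp'
  ext t
  by_contra ht
  obtain ⟨l, n, hn, hn', rfl⟩ := exists_eq_fanTriangle_of_apply_ne_zero hκ hz ht
  obtain ⟨a, h0a, b, hab, hbl⟩ := exists_chain_of_facets l
  exact ht (step hbl (step hab (step h0a fun p hp hp' =>
    apply_fanTriangle_eq_zero hκ hz hm hm' h hp hp')) n hn hn')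

/-! ### The fundamental cycle -/

/-- The facet `i`, triangulated by the diagonals through the corner `k`. -/
noncomputable def fan (i : Fin 12) (k : Fin 5) : Finset (Fin 20) →₀ ℤ :=
  orientedTriangle (corner i k) (corner i (k + 1)) (corner i (k + 2)) +
    orientedTriangle (corner i k) (corner i (k + 2)) (corner i (k + 3)) +
    orientedTriangle (corner i k) (corner i (k + 3)) (corner i (k + 4))

theorem nodup_corners : ∀ i k, [corner i k, corner i (k + 1), corner i (k + 2), corner i (k + 3),
    corner i (k + 4)].Nodup := by
  decide +kernel

/-- The diagonals cancel, so the boundary of a fan does not depend on its apex. -/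
theorem boundary_fan_eq_sum (i : Fin 12) (k : Fin 5) :
    boundary (fan i k) = ∑ m, orientedEdge (corner i m) (corner i (m + 1)) := by
  rw [fan, boundary_fan (nodup_corners i k),
    ← Equiv.sum_comp (Equiv.addLeft k) fun m => orientedEdge (corner i m) (corner i (m + 1)),
    Fin.sum_univ_five]
  have h1 : k + 1 + 1 = k + 2 := by rw [add_assoc]; rfl
  have h2 : k + 2 + 1 = k + 3 := by rw [add_assoc]; rfl
  have h3 : k + 3 + 1 = k + 4 := by rw [add_assoc]; rfl
  have h4 : k + 4 + 1 = k := by rw [add_assoc]; exact add_zero k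
  simp only [Equiv.coe_addLeft, add_zero, h1, h2, h3, h4]

theorem eq_of_corner_eq : ∀ i m j n, corner i m = corner j n →
    corner i (m + 1) = corner j (n + 1) → i = j ∧ m = n := by
  decide +kernel

/-- All facets are listed counterclockwise, so each edge is traversed once in each direction by its
two facets. -/
theorem sum_orientedEdge_eq_zero :
    ∑ p : Fin 12 × Fin 5, orientedEdge (corner p.1 p.2) (corner p.1 (p.2 + 1)) = 0 := by
  choose l n h using exists_adjacentAt
  have hne : ∀ i m, corner i m ≠ corner i (m + 1) := fun i m h => by
    have := hops_corner_succ i m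
    rw [hops_eq_zero.2 h] at this
    omega
  refine Finset.sum_involution (fun p _ => (l p.1 p.2, n p.1 p.2)) ?_ ?_ ?_ ?_
  · rintro ⟨i, m⟩ -
    simp only
    rw [← (h i m).1, ← (h i m).2, orientedEdge_swap (hne i m), add_neg_cancel]
  · rintro ⟨i, m⟩ - - hp
    simp only [Prod.mk.injEq] at hp
    have := (h i m).2
    rw [hp.1, hp.2] at this
    exact hne i m this.symm
  · rintro ⟨i, m⟩ -
    exact Finset.mem_univ _
  · rintro ⟨i, m⟩ -
    have h' := h (l i m) (n i m)
    obtain ⟨h1, h2⟩ := eq_of_corner_eq _ _ i m (h'.2.symm.trans (h i m).1.symm)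
      (h'.1.symm.trans (h i m).2.symm)
    exact Prod.ext h1 h2

/-- The intersection number of the ray with the facet `i` triangulated from the corner `k`. -/
def rayFan (i : Fin 12) (k : Fin 5) : ℤ :=
  let t (x y z : Fin 20) : ℤ := orient x y * orient x z * orient y z * rayTriangle x y z
  t (corner i k) (corner i (k + 1)) (corner i (k + 2)) +
    t (corner i k) (corner i (k + 2)) (corner i (k + 3)) +
    t (corner i k) (corner i (k + 3)) (corner i (k + 4))

theorem rayCochain_fan (i : Fin 12) (k : Fin 5) : rayCochain (fan i k) = rayFan i k := by
  have h := nodup_corners i k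
  simp only [List.nodup_cons, List.mem_cons, List.not_mem_nil, not_or, or_false] at h
  obtain ⟨⟨ab, ac, ad, ae⟩, ⟨bc, bd, be⟩, ⟨cd, ce⟩, de, -⟩ := h
  rw [fan, map_add, map_add, rayCochain_orientedTriangle ab ac bc,
    rayCochain_orientedTriangle ac ad cd, rayCochain_orientedTriangle ad ae de]
  rfl

/-- Two fans of a facet differ by boundaries of tetrahedra inside the facet, on which the cochain
vanishes. Therefore one normalisation, `sum_rayFan`, serves all choices of apexes. -/
theorem rayFan_eq : ∀ i k, rayFan i k = rayFan i 0 := by decide +kernel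

theorem sum_rayFan : ∑ i, rayFan i 0 = 1 := by decide +kernel

theorem orientedTriangle_mem_chains (hκ : ∀ i, apex (facet i) = corner i (κ i)) (i : Fin 12)
    {m : Fin 5} (hm : m ≠ κ i) (hm' : m + 1 ≠ κ i) :
    orientedTriangle (corner i (κ i)) (corner i m) (corner i (m + 1)) ∈
      chains (boundarySphere apex) 2 := by
  rw [orientedTriangle, ← fanTriangle_eq]
  exact Finsupp.single_mem_supported ℤ _
    ⟨fanTriangle_mem_boundarySphere hκ i m, card_fanTriangle i hm hm'⟩

theorem fan_mem_chains (hκ : ∀ i, apex (facet i) = corner i (κ i)) (i : Fin 12) :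
    fan i (κ i) ∈ chains (boundarySphere apex) 2 := by
  have h : ∀ k : Fin 5, (k + 1 ≠ k ∧ k + 2 ≠ k ∧ k + 3 ≠ k ∧ k + 4 ≠ k) ∧
      k + 2 = k + 1 + 1 ∧ k + 3 = k + 2 + 1 ∧ k + 4 = k + 3 + 1 := by decide
  obtain ⟨⟨n1, n2, n3, n4⟩, e2, e3, e4⟩ := h (κ i)
  refine Submodule.add_mem _ (Submodule.add_mem _ ?_ ?_) ?_
  · rw [e2] at n2 ⊢
    exact orientedTriangle_mem_chains hκ i n1 n2
  · rw [e3] at n3 ⊢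
    exact orientedTriangle_mem_chains hκ i n2 n3
  · rw [e4] at n4 ⊢
    exact orientedTriangle_mem_chains hκ i n3 n4

theorem exists_fundamental_cycle (hκ : ∀ i, apex (facet i) = corner i (κ i)) :
    ∃ g ∈ cycles (boundarySphere apex) 2, rayCochain g = 1 := by
  refine ⟨∑ i, fan i (κ i), ⟨Submodule.sum_mem _ fun i _ => fan_mem_chains hκ i, ?_⟩, ?_⟩
  · refine LinearMap.mem_ker.2 ?_
    rw [map_sum, Finset.sum_congr rfl fun i _ => boundary_fan_eq_sum i (κ i),
      ← sum_orientedEdge_eq_zero, Fintype.sum_prod_type]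
  · rw [map_sum, ← sum_rayFan]
    exact Finset.sum_congr rfl fun i _ => (rayCochain_fan i _).trans (rayFan_eq i _)

theorem exists_apex : ∃ apex : Finset (Fin 20) → Fin 20, ∀ F, IsFacet F → apex F ∈ F := by
  have hne : ∀ F : Finset (Fin 20), ∃ x, IsFacet F → x ∈ F := by
    intro F
    by_cases hF : IsFacet F
    · exact (Finset.card_pos.1 (show 0 < F.card by rw [hF.1]; norm_num)).imp fun _ hx _ => hx
    -- The value on sets that are not facets is irrelevant.
    · exact ⟨0, fun h => absurd h hF⟩
  exact ⟨_, fun F => (hne F).choose_spec⟩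

theorem exists_apex_corner (hapex : ∀ F, IsFacet F → apex F ∈ F) :
    ∃ κ : Fin 12 → Fin 5, ∀ i, apex (facet i) = corner i (κ i) := by
  choose κ hκ using fun i => exists_corner_of_mem_facet (hapex _ (isFacet_facet i))
  exact ⟨κ, fun i => (hκ i).symm⟩

theorem eq_zero_of_rayCochain_eq_zero (hapex : ∀ F, IsFacet F → apex F ∈ F)
    {z : Finset (Fin 20) →₀ ℤ} (hz : z ∈ cycles (boundarySphere apex) 2)
    (h : rayCochain z = 0) : z = 0 := by
  obtain ⟨κ, hκ⟩ := exists_apex_corner hapex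
  obtain ⟨g, hg, hg1⟩ := exists_fundamental_cycle hκ
  have hne : ∀ k : Fin 5, k + 1 ≠ k ∧ k + 1 + 1 ≠ k := by decide
  obtain ⟨n1, n2⟩ := hne (κ 0)
  -- This combination of `z` and the fundamental cycle `g` vanishes at one triangle, hence
  -- everywhere. Applying `rayCochain`, with values 0 on `z` and 1 on `g`, shows that the
  -- coefficient of `z` at this triangle is 0.
  have h0 : g (fanTriangle 0 (κ 0) (κ 0 + 1)) • z - z (fanTriangle 0 (κ 0) (κ 0 + 1)) • g = 0 :=
    eq_zero_of_apply_eq_zero hκ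
      (Submodule.sub_mem _ (Submodule.smul_mem _ _ hz) (Submodule.smul_mem _ _ hg)) n1 n2
      (by simp [mul_comm])
  have h1 := congrArg rayCochain h0
  rw [map_sub, map_smul, map_smul, h, hg1, map_zero, smul_zero, zero_sub, neg_eq_zero,
    smul_eq_mul, mul_one] at h1
  exact eq_zero_of_apply_eq_zero hκ hz n1 n2 h1

/-! ### Homology -/

/-- An arbitrary triangulation of the sphere serves as an auxiliary complex: the cycle is homologous
to one on the sphere with the same value 0, and that one is zero. -/
theorem mem_boundaries_vietorisRips_two {z : Finset (Fin 20) →₀ ℤ}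
    (hz : z ∈ cycles (vietorisRips graph 2) 2) (h : rayCochain z = 0) :
    z ∈ boundaries (vietorisRips graph 2) 2 := by
  obtain ⟨apex, hapex⟩ := exists_apex
  obtain ⟨y, hy, hzy⟩ := exists_cycle_boundarySphere hapex hz
  have h0 := rayCochain_eq_zero_of_mem_boundaries _
    (Submodule.map_mono (chains_mono vietorisRips_two_le 3) hzy)
  rw [map_sub, h, zero_sub, neg_eq_zero] at h0
  rwa [eq_zero_of_rayCochain_eq_zero hapex hy h0, sub_zero] at hzy

theorem mem_boundaries_reducedVR {z : Finset (Fin 20) →₀ ℤ} (hz : z ∈ cycles reducedVR 2)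
    (h : rayCochain z = 0) : z ∈ boundaries reducedVR 2 := by
  obtain ⟨y, hy, hzy⟩ := exists_cycle_vietorisRips_two hz
  have h0 := rayCochain_eq_zero_of_mem_boundaries _ hzy
  rw [map_sub, h, zero_sub, neg_eq_zero] at h0
  have hy' : y ∈ boundaries reducedVR 2 :=
    Submodule.map_mono (chains_mono vietorisRips_two_le 3) (mem_boundaries_vietorisRips_two hy h0)
  exact (Submodule.sub_mem_iff_left _ hy').1 hzy

end Dodecahedron

open SimplicialHomology Dodecahedron in
theorem mainTheorem3 :
    (distanceThreeTetrahedra graph).ncard = 10 ∧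
    reducedVR.faces = (vietorisRips graph 3).faces \ distanceThreeTetrahedra graph ∧
    (∀ τ ∈ distanceThreeTetrahedra graph,
      ∃ h : boundary (Finsupp.single τ 1) ∈ cycles reducedVR 2,
        Submodule.span ℤ {homologyClass reducedVR 2 _ h} = ⊤) ∧
    Function.Bijective (homologyMap vietorisRips_two_le 2) ∧
    (∀ (apex : Finset (Fin 20) → Fin 20) (hapex : ∀ F, IsFacet F → apex F ∈ F),
      Function.Bijective (homologyMap (boundarySphere_le hapex) 2) ∧
      Nonempty (Homology (boundarySphere apex) 2 ≃ₗ[ℤ] ℤ)) ∧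
    Nonempty (Homology (vietorisRips graph 2) 2 ≃ₗ[ℤ] ℤ) ∧
    Nonempty (Homology reducedVR 2 ≃ₗ[ℤ] ℤ) := by
  obtain ⟨apex₀, hapex₀⟩ := exists_apex
  have hzero : ∀ b ∈ boundaries (vietorisRips graph 2) 2, rayCochain b = 0 := fun b hb =>
    rayCochain_eq_zero_of_mem_boundaries b
      (Submodule.map_mono (chains_mono vietorisRips_two_le 3) hb)
  have hT : ∀ (apex : Finset (Fin 20) → Fin 20) (_ : ∀ F, IsFacet F → apex F ∈ F),
      ∃ e : Homology (boundarySphere apex) 2 ≃ₗ[ℤ] ℤ,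
        ∀ z hz, e (homologyClass (boundarySphere apex) 2 z hz) = rayCochain z := by
    intro apex hapex
    obtain ⟨κ, hκ⟩ := exists_apex_corner hapex
    refine exists_homology_equiv rayCochain (fun b hb => hzero b
      (Submodule.map_mono (chains_mono (boundarySphere_le hapex) 3) hb))
      (exists_fundamental_cycle hκ) fun z hz h => ?_
    rw [eq_zero_of_rayCochain_eq_zero hapex hz h]
    exact Submodule.zero_mem _
  obtain ⟨κ, hκ⟩ := exists_apex_corner hapex₀
  obtain ⟨g, hg, hg1⟩ := exists_fundamental_cycle hκ
  -- The fundamental cycle of one triangulation also provides the cycle of value 1 for both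
  -- Vietoris-Rips complexes.
  have hg2 := cycles_mono (boundarySphere_le hapex₀) 2 hg
  obtain ⟨eV, hV⟩ := exists_homology_equiv rayCochain hzero ⟨g, hg2, hg1⟩
    fun z hz h => mem_boundaries_vietorisRips_two hz h
  obtain ⟨eR, hR⟩ := exists_homology_equiv rayCochain rayCochain_eq_zero_of_mem_boundaries
    ⟨g, cycles_mono vietorisRips_two_le 2 hg2, hg1⟩ fun z hz h => mem_boundaries_reducedVR hz h
  refine ⟨ncard_distanceThreeTetrahedra, faces_reducedVR, fun τ hτ =>
    ⟨boundary_mem_cycles_reducedVR hτ,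
      span_homologyClass_eq_top hR _ (isUnit_rayCochain_boundary hτ)⟩,
    homologyMap_bijective vietorisRips_two_le hV hR, fun apex hapex => ?_, ⟨eV⟩, ⟨eR⟩⟩
  obtain ⟨eT, hT⟩ := hT apex hapex
  exact ⟨homologyMap_bijective (boundarySphere_le hapex) hT hV, ⟨eT⟩⟩
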